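/- Let $F$ be a totally real number field with adele ring $\mathbb A$, and let $|\cdot|$ denote the idele norm on $\mathbb A^\times$. Let $\omega:\mathbb A^\times\to\{z\in\mathbb C:|z|=1\}$ be a unitary Hecke character, i.e. a continuous character trivial on $F^\times$. Let $\mathcal S(\mathbb A^2)$ be the space of Schwartz--Bruhat functions, i.e. the complex linear span of the functions $x\mapsto\varphi_f(x_f)\varphi_\infty(x_\infty)$ with $\varphi_f$ locally constant with compact support on $\mathbb A_f^2$ and $\varphi_\infty$ a Schwartz function on $\mathbb A_\infty^2$ (with $\mathbb A_\infty\cong\mathbb R^{[F:\mathbb Q]}$). Let $\mathrm{GL}_2(\mathbb A)$ act on functions on $\mathbb A^2$ (column vectors) by $(g\varphi)(x)=\varphi(g^{-1}x)$. Fix a Haar measure $d^\times t$ on $\mathbb A^\times$ and give $\mathbb A^\times/F^\times$ the quotient measure (by the counting measure on $F^\times$), also written $d^\times t$. For $\varphi\in\mathcal S(\mathbb A^2)$, $g\in\mathrm{GL}_2(\mathbb A)$ and $s\in\mathbb C$ put $$\Theta(\varphi)(g)=\sum_{v\in F^2\setminus\{0\}}(g\varphi)(v),\qquad E^{\rm ana}_{\omega,s}(\varphi)(g)=|\det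 g|^{-s}\int_{\mathbb A^\times/F^\times}\omega(t)\,|t|^{2s}\,\Theta(\varphi)(g/t)\,d^\times t,$$ $$\zeta_{\omega,s}(\varphi)(g)=|\det g|^{-s}\int_{\mathbb A^\times}|t|^{2s}\,\omega(t)\,(g\varphi)\binom t0\,d^\times t.$$ Suppose that $\mathrm{Re}(s)>1$. Then the series defining $\Theta(\varphi)(h)$ and the integral defining $\zeta_{\omega,s}(\varphi)(h)$ converge absolutely for every $h\in\mathrm{GL}_2(\mathbb A)$, and the integral defining $E^{\rm ana}_{\omega,s}(\varphi)(g)$ converges absolutely. Let $B(F)\subset\mathrm{GL}_2(F)$ be the subgroup of upper triangular matrices. The function $\gamma\mapsto\zeta_{\omega,s}(\varphi)(\gamma g)$ on $\mathrm{GL}_2(F)$ is left invariant under $B(F)$, and $$E^{\rm ana}_{\omega,s}(\varphi)(g)=\sum_{\gamma\in B(F)\backslash\mathrm{GL}_2(F)}\zeta_{\omega,s}(\varphi)(\gamma g),$$ where the series converges absolutely. -/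

import Mathlib

open NumberField IsDedekindDomain MeasureTheory
open scoped NumberField.AdeleRing SchwartzMap MatrixGroups

noncomputable section

namespace AdelicEisenstein

variable (F : Type*) [Field F] [NumberField F]

/-- The idele group of `F` carries the Borel σ-algebra of its (restricted product) topology. -/
instance : MeasurableSpace (𝔸[F])ˣ := borel _

instance : BorelSpace (𝔸[F])ˣ := ⟨rfl⟩

/-- The diagonal embedding of `Fˣ` in the idele group. -/
def principalIdele : Fˣ →* (𝔸[F])ˣ := Units.map (algebraMap F 𝔸[F]).toMonoidHom

/-- The subgroup `Fˣ` of the idele group. -/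
def principalIdeles : Subgroup (𝔸[F])ˣ := (principalIdele F).range

variable {F}

theorem finite_mulSupport_norm (t : (𝔸[F])ˣ) :
    (Function.mulSupport
      (fun v : HeightOneSpectrum (𝓞 F) => ‖(t : 𝔸[F]).2 v‖)).Finite := by
  have hu : IsUnit ((t : 𝔸[F]).2) := by
    refine ⟨⟨(t : 𝔸[F]).2, ((t⁻¹ : (𝔸[F])ˣ) : 𝔸[F]).2, ?_, ?_⟩, rfl⟩
    · exact congrArg Prod.snd (t.mul_inv)
    · exact congrArg Prod.snd (t.inv_mul)
  have h := (FiniteAdeleRing.isUnit_iff.1 hu).2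
  refine Set.Finite.subset h ?_
  intro v hv hv'
  apply hv
  simp only [FinitePlace.norm_def]
  rw [hv']
  simp

/-- The idele norm `|t|`: the product of the normalised absolute values of the components
of `t` at all the places of `F`. -/
def ideleNorm : (𝔸[F])ˣ →* ℝ where
  toFun t := (∏ v : InfinitePlace F, ‖(t : 𝔸[F]).1 v‖ ^ v.mult) *
    ∏ᶠ v : HeightOneSpectrum (𝓞 F), ‖(t : 𝔸[F]).2 v‖
  map_one' := by
    change (∏ v : InfinitePlace F, ‖(1 : v.Completion)‖ ^ v.mult) *
      ∏ᶠ v : HeightOneSpectrum (𝓞 F), ‖(1 : v.adicCompletion F)‖ = 1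
    simp
  map_mul' t u := by
    have h1 : ∀ v : InfinitePlace F,
      ((t * u : (𝔸[F])ˣ) : 𝔸[F]).1 v = (t : 𝔸[F]).1 v * (u : 𝔸[F]).1 v := fun v => rfl
    have h2 : ∀ v : HeightOneSpectrum (𝓞 F),
      ((t * u : (𝔸[F])ˣ) : 𝔸[F]).2 v = (t : 𝔸[F]).2 v * (u : 𝔸[F]).2 v := fun v => rfl
    simp only [h1, h2, norm_mul, mul_pow, Finset.prod_mul_distrib]
    rw [finprod_mul_distrib (finite_mulSupport_norm t) (finite_mulSupport_norm u)]
    ring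

/-- The product formula. -/
theorem ideleNorm_principalIdele (a : Fˣ) : ideleNorm (principalIdele F a) = 1 := by
  have h := prod_abs_eq_one (K := F) a.ne_zero
  rw [← h]
  change (∏ v : InfinitePlace F, ‖((a : F) : v.Completion)‖ ^ v.mult) *
    ∏ᶠ v : HeightOneSpectrum (𝓞 F), ‖FinitePlace.embedding v (a : F)‖ = _
  congr 1
  · refine Finset.prod_congr rfl fun v _ => ?_
    rw [InfinitePlace.Completion.norm_coe]
    rfl
  · rw [← finprod_comp_equiv FinitePlace.equivHeightOneSpectrum]
    refine finprod_congr fun w => ?_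
    exact FinitePlace.norm_embedding_eq w a

variable (F) in
/-- A unitary Hecke character: a continuous homomorphism from the idele group to the unit circle
that is trivial on `Fˣ`. -/
structure UnitaryHeckeCharacter extends (𝔸[F])ˣ →ₜ* Circle where
  map_principalIdele' : ∀ a : Fˣ, toFun (principalIdele F a) = 1

namespace UnitaryHeckeCharacter

/-- The value `ω(t)`, as a complex number. -/
def eval (ω : UnitaryHeckeCharacter F) (t : (𝔸[F])ˣ) : ℂ :=
  (ω.toContinuousMonoidHom t : ℂ)

theorem eval_principalIdele_mul (ω : UnitaryHeckeCharacter F) (a : Fˣ) (t : (𝔸[F])ˣ) :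
    ω.eval (principalIdele F a * t) = ω.eval t := by
  have h : ω.toContinuousMonoidHom (principalIdele F a) = 1 := ω.map_principalIdele' a
  simp only [eval, map_mul, h, one_mul]

end UnitaryHeckeCharacter

section SchwartzBruhat

/-- The identification of the archimedean part of an adele vector with a family of real numbers. -/
def realCoords [IsTotallyReal F] (x : Fin 2 → 𝔸[F]) : Fin 2 → InfinitePlace F → ℝ :=
  fun i v => InfinitePlace.Completion.extensionEmbeddingOfIsReal (IsTotallyReal.isReal v)
    ((x i).1 v)

/-- The non-archimedean part of an adele vector. -/
def finiteCoords (x : Fin 2 → 𝔸[F]) : Fin 2 → 𝔸ᶠ[F] := fun i => (x i).2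

variable (F) in
/-- The space of Schwartz-Bruhat functions on `𝔸²`: the linear span of the functions
`x ↦ φ_f(x_f) φ_∞(x_∞)` with `φ_f` locally constant with compact support and `φ_∞` a Schwartz
function. -/
def schwartzBruhat [IsTotallyReal F] : Submodule ℂ ((Fin 2 → 𝔸[F]) → ℂ) :=
  Submodule.span ℂ {φ | ∃ (φf : (Fin 2 → 𝔸ᶠ[F]) → ℂ)
      (φi : 𝓢(Fin 2 → InfinitePlace F → ℝ, ℂ)),
    IsLocallyConstant φf ∧ HasCompactSupport φf ∧
      φ = fun x => φf (finiteCoords x) * φi (realCoords x)}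

end SchwartzBruhat

/-- The left action `(gφ)(x) = φ(g⁻¹ x)` on functions of column vectors. -/
def act (g : GL (Fin 2) 𝔸[F]) (φ : (Fin 2 → 𝔸[F]) → ℂ) : (Fin 2 → 𝔸[F]) → ℂ :=
  fun x => φ (((g⁻¹ : GL (Fin 2) 𝔸[F]) : Matrix (Fin 2) (Fin 2) 𝔸[F]).mulVec x)

/-- The diagonal embedding of `F²` in `𝔸²`. -/
def diag (v : Fin 2 → F) : Fin 2 → 𝔸[F] := fun i => algebraMap F 𝔸[F] (v i)

/-- The term `(gφ)(v)` of the theta series, for `v ∈ F² ∖ {0}`. -/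
def thetaTerm (φ : (Fin 2 → 𝔸[F]) → ℂ) (g : GL (Fin 2) 𝔸[F])
    (v : {v : Fin 2 → F // v ≠ 0}) : ℂ :=
  act g φ (diag v.1)

/-- The theta function `Θ(φ)(g) = ∑_{v ∈ F² ∖ {0}} (gφ)(v)`. -/
def theta (φ : (Fin 2 → 𝔸[F]) → ℂ) (g : GL (Fin 2) 𝔸[F]) : ℂ :=
  ∑' v : {v : Fin 2 → F // v ≠ 0}, thetaTerm φ g v

/-- The function `ω(t) |t|^{2s} Θ(φ)(g/t)` of an idele `t`. -/
def eisensteinIntegrand (ω : UnitaryHeckeCharacter F) (s : ℂ) (φ : (Fin 2 → 𝔸[F]) → ℂ)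
    (g : GL (Fin 2) 𝔸[F]) (t : (𝔸[F])ˣ) : ℂ :=
  ω.eval t * (ideleNorm t : ℂ) ^ (2 * s) *
    theta φ (g * (Matrix.GeneralLinearGroup.scalar (Fin 2) t)⁻¹)

theorem act_mul_scalar_inv (g : GL (Fin 2) 𝔸[F]) (t : (𝔸[F])ˣ) (φ : (Fin 2 → 𝔸[F]) → ℂ)
    (x : Fin 2 → 𝔸[F]) :
    act (g * (Matrix.GeneralLinearGroup.scalar (Fin 2) t)⁻¹) φ x =
      act g φ ((t : 𝔸[F]) • x) := by
  unfold act
  rw [mul_inv_rev, inv_inv, Matrix.GeneralLinearGroup.scalar_commute, Units.val_mul,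
    ← Matrix.mulVec_mulVec, Matrix.GeneralLinearGroup.coe_scalar]
  congr 2
  ext i
  simp [Matrix.scalar_apply, Matrix.mulVec_diagonal]

theorem theta_principalIdele_mul (φ : (Fin 2 → 𝔸[F]) → ℂ) (g : GL (Fin 2) 𝔸[F]) (a : Fˣ)
    (t : (𝔸[F])ˣ) :
    theta φ (g * (Matrix.GeneralLinearGroup.scalar (Fin 2) (principalIdele F a * t))⁻¹) =
      theta φ (g * (Matrix.GeneralLinearGroup.scalar (Fin 2) t)⁻¹) := by
  let e : {v : Fin 2 → F // v ≠ 0} ≃ {v : Fin 2 → F // v ≠ 0} :=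
    { toFun := fun v => ⟨a • v.1, (smul_ne_zero_iff_ne a).2 v.2⟩
      invFun := fun v => ⟨a⁻¹ • v.1, (smul_ne_zero_iff_ne a⁻¹).2 v.2⟩
      left_inv := fun v => by simp
      right_inv := fun v => by simp }
  unfold theta
  rw [← e.tsum_eq (fun v => thetaTerm φ (g * (Matrix.GeneralLinearGroup.scalar (Fin 2) t)⁻¹) v)]
  refine tsum_congr fun v => ?_
  unfold thetaTerm
  rw [act_mul_scalar_inv, act_mul_scalar_inv]
  congr 1
  ext1 i
  change algebraMap F 𝔸[F] a * (t : 𝔸[F]) * algebraMap F 𝔸[F] (v.1 i) =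
    (t : 𝔸[F]) * algebraMap F 𝔸[F] ((a : F) * v.1 i)
  rw [map_mul]
  ring

theorem eisensteinIntegrand_principalIdele_mul (ω : UnitaryHeckeCharacter F) (s : ℂ)
    (φ : (Fin 2 → 𝔸[F]) → ℂ) (g : GL (Fin 2) 𝔸[F]) (a : Fˣ) (t : (𝔸[F])ˣ) :
    eisensteinIntegrand ω s φ g (principalIdele F a * t) = eisensteinIntegrand ω s φ g t := by
  unfold eisensteinIntegrand
  rw [ω.eval_principalIdele_mul, theta_principalIdele_mul, map_mul, ideleNorm_principalIdele,
    one_mul]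

/-- The function `ω(t) |t|^{2s} Θ(φ)(g/t)` on the idele class group `𝔸ˣ/Fˣ`. -/
def eisensteinClassIntegrand (ω : UnitaryHeckeCharacter F) (s : ℂ) (φ : (Fin 2 → 𝔸[F]) → ℂ)
    (g : GL (Fin 2) 𝔸[F]) (x : (𝔸[F])ˣ ⧸ principalIdeles F) : ℂ :=
  Quotient.liftOn' x (eisensteinIntegrand ω s φ g) (by
    intro t u h
    rw [QuotientGroup.leftRel_apply] at h
    obtain ⟨a, ha⟩ := h
    have : u = principalIdele F a * t := by
      rw [ha, mul_comm t⁻¹ u, inv_mul_cancel_right]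
    rw [this, eisensteinIntegrand_principalIdele_mul])

/-- The Eisenstein series
`|det g|^{-s} ∫_{𝔸ˣ/Fˣ} ω(t) |t|^{2s} Θ(φ)(g/t) dˣt`, for a measure `ν` on `𝔸ˣ/Fˣ`. -/
def eisensteinSeries (ν : Measure ((𝔸[F])ˣ ⧸ principalIdeles F)) (ω : UnitaryHeckeCharacter F)
    (s : ℂ) (φ : (Fin 2 → 𝔸[F]) → ℂ) (g : GL (Fin 2) 𝔸[F]) : ℂ :=
  (ideleNorm (Matrix.GeneralLinearGroup.det g) : ℂ) ^ (-s) *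
    ∫ x, eisensteinClassIntegrand ω s φ g x ∂ν

/-- The function `|t|^{2s} ω(t) (gφ)(t, 0)` of an idele `t`. -/
def zetaIntegrand (ω : UnitaryHeckeCharacter F) (s : ℂ) (φ : (Fin 2 → 𝔸[F]) → ℂ)
    (g : GL (Fin 2) 𝔸[F]) (t : (𝔸[F])ˣ) : ℂ :=
  (ideleNorm t : ℂ) ^ (2 * s) * ω.eval t * act g φ ![(t : 𝔸[F]), 0]

/-- `ζ_{ω,s}(φ)(g) = |det g|^{-s} ∫_{𝔸ˣ} |t|^{2s} ω(t) (gφ)(t, 0) dˣt`, for a measure `μ`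
on `𝔸ˣ`. -/
def zetaIntegral (μ : Measure (𝔸[F])ˣ) (ω : UnitaryHeckeCharacter F) (s : ℂ)
    (φ : (Fin 2 → 𝔸[F]) → ℂ) (g : GL (Fin 2) 𝔸[F]) : ℂ :=
  (ideleNorm (Matrix.GeneralLinearGroup.det g) : ℂ) ^ (-s) *
    ∫ t, zetaIntegrand ω s φ g t ∂μ

variable (F) in
/-- The Borel subgroup `B(F)` of `GL₂(F)`: the matrices with zero lower left entry. -/
def borelSubgroup : Subgroup (GL (Fin 2) F) where
  carrier := {b | (b : Matrix (Fin 2) (Fin 2) F) 1 0 = 0}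
  one_mem' := by simp
  mul_mem' {a b} ha hb := by
    simp only [Set.mem_ofPred_eq] at ha hb ⊢
    simp [Matrix.mul_apply, Fin.sum_univ_two, ha, hb]
  inv_mem' {a} ha := by
    simp only [Set.mem_ofPred_eq] at ha ⊢
    simp [Matrix.inv_def, Matrix.adjugate_fin_two, ha]

variable (F) in
/-- The embedding `GL₂(F) → GL₂(𝔸)`. -/
def toAdelic : GL (Fin 2) F →* GL (Fin 2) 𝔸[F] :=
  Matrix.GeneralLinearGroup.map (algebraMap F 𝔸[F])

theorem zetaIntegral_borel_mul (μ : Measure (𝔸[F])ˣ) [μ.IsHaarMeasure]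
    (ω : UnitaryHeckeCharacter F) (s : ℂ) (φ : (Fin 2 → 𝔸[F]) → ℂ) (g : GL (Fin 2) 𝔸[F])
    (b : GL (Fin 2) F) (hb : b ∈ borelSubgroup F) :
    zetaIntegral μ ω s φ (toAdelic F b * g) = zetaIntegral μ ω s φ g := by
  have hb' : ((b⁻¹ : GL (Fin 2) F) : Matrix (Fin 2) (Fin 2) F) 1 0 = 0 :=
    (borelSubgroup F).inv_mem hb
  have ha : ((b⁻¹ : GL (Fin 2) F) : Matrix (Fin 2) (Fin 2) F) 0 0 ≠ 0 := by
    intro h0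
    have hd := (Matrix.GeneralLinearGroup.det (b⁻¹)).ne_zero
    rw [Matrix.GeneralLinearGroup.val_det_apply, Matrix.det_fin_two, h0, hb'] at hd
    simp at hd
  have hdet : ideleNorm (Matrix.GeneralLinearGroup.det (toAdelic F b * g)) =
      ideleNorm (Matrix.GeneralLinearGroup.det g) := by
    have h1 : Matrix.GeneralLinearGroup.det (toAdelic F b) =
        principalIdele F (Matrix.GeneralLinearGroup.det b) := by
      ext
      exact ((algebraMap F 𝔸[F]).map_det _).symm
    rw [map_mul, map_mul, h1, ideleNorm_principalIdele, one_mul]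
  have hint : ∀ t : (𝔸[F])ˣ, zetaIntegrand ω s φ (toAdelic F b * g) t =
      zetaIntegrand ω s φ g (principalIdele F (Units.mk0 _ ha) * t) := by
    intro t
    unfold zetaIntegrand
    rw [ω.eval_principalIdele_mul, map_mul, ideleNorm_principalIdele, one_mul]
    congr 1
    unfold act
    rw [mul_inv_rev, Units.val_mul, ← Matrix.mulVec_mulVec, ← map_inv]
    congr 2
    ext1 i
    have h0 : ∀ i j, ((toAdelic F b⁻¹ : GL (Fin 2) 𝔸[F]) : Matrix (Fin 2) (Fin 2) 𝔸[F]) i j =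
      algebraMap F 𝔸[F] (((b⁻¹ : GL (Fin 2) F) : Matrix (Fin 2) (Fin 2) F) i j) := fun i j => rfl
    fin_cases i
    · simp only [Matrix.mulVec, dotProduct, Fin.sum_univ_two, h0]
      simp [principalIdele]
    · simp only [Matrix.mulVec, dotProduct, Fin.sum_univ_two, h0]
      simp [hb']
  unfold zetaIntegral
  rw [hdet]
  congr 1
  simp_rw [hint]
  exact integral_mul_left_eq_self (zetaIntegrand ω s φ g) _

/-- The function `γ ↦ ζ_{ω,s}(φ)(γg)` on `B(F)\GL₂(F)`. -/
def zetaCoset (μ : Measure (𝔸[F])ˣ) [μ.IsHaarMeasure]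
    (ω : UnitaryHeckeCharacter F) (s : ℂ) (φ : (Fin 2 → 𝔸[F]) → ℂ) (g : GL (Fin 2) 𝔸[F])
    (q : Quotient (QuotientGroup.rightRel (borelSubgroup F))) : ℂ :=
  Quotient.liftOn' q (fun γ => zetaIntegral μ ω s φ (toAdelic F γ * g)) (by
    intro γ δ h
    rw [QuotientGroup.rightRel_apply] at h
    have : δ = (δ * γ⁻¹) * γ := by group
    rw [this, map_mul, mul_assoc, zetaIntegral_borel_mul μ ω s φ _ _ h])

end AdelicEisenstein

end

/-!
The Eisenstein series is unfolded. Over a fundamental domain `D` of `Fˣ` in the idele group, it is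
the integral of `∑ v, ω(t) |t|^{2s} (gφ)(tv)`, the sum running over the nonzero `v ∈ F²`. The group
`GL₂(F)` acts transitively on these vectors and `B(F)` is the stabiliser of the line through
`(1, 0)`, so that each of them is `γ⁻¹ (a, 0)` for exactly one coset `B(F)γ` (with a representative
fixed) and one `a ∈ Fˣ` (`bijective_cosetVector`). For a fixed coset, the sum over `a ∈ Fˣ` of the
integrals over `D` is one integral over all ideles (`integral_zetaIntegrand_toAdelic_mul`), namely
the zeta integral at `γ g`; the factor `|det g|^{-s}` is the same at `γ g` and at `g` by the product
formula.

Everything else is absolute convergence, that is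
`∫_D ∑ v, |t|^{2 Re s} |(gφ)(tv)| dˣt < ∞` (`setLIntegral_tsum_enorm_thetaSummand_lt_top`). Let `z`
be the idele equal to `2` at the infinite places and to `1` at the finite ones (`archTwo`).
Finiteness of the class group and Dirichlet's unit theorem show that every idele is of the form
`a zⁿ k` with `a ∈ Fˣ`, `n ∈ ℤ` and `k` in a fixed compact set `K`
(`exists_isCompact_principalIdele_mul_archTwo_zpow_mul`). The integrand being invariant under `Fˣ`,
its integral over `D` is at most the sum over `n` of its integrals over the sets `zⁿ K`, all of the
same finite measure. For `t ∈ K` the value `(gφ)(zⁿ t v)` vanishes unless `v` lies in a fixed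
lattice in `F²`, and otherwise is at most a multiple of `(2ⁿ ‖v‖)^(-α)`, for any `α ≥ 0`
(`norm_act_le_of_mem_schwartzBruhat`). With `d = [F : ℚ]`, the lattice has rank `2d`, so for
`α > 2d` the sum over `v` converges and the integrand on `zⁿ K` is
`O(2^{n (2 d Re s - α)})`. A large `α` makes this summable over `n ≥ 0`, and since `Re s > 1` there
is an `α` with `2d < α < 2 d Re s`, which makes it summable over `n ≤ 0`.
-/

namespace AdelicEisenstein
open HeightOneSpectrum

/-! ### Compactness in the finite adeles -/

section FiniteAdeles
variable {F : Type*} [Field F] [NumberField F]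

/-- Every `v`-adic integer is congruent to an element of `𝓞 F` modulo the maximal ideal. -/
theorem exists_integer_sub_lt_one (v : HeightOneSpectrum (𝓞 F)) (x : v.adicCompletionIntegers F) :
    ∃ r : 𝓞 F, Valued.v ((x : v.adicCompletion F) -
      algebraMap (𝓞 F) (v.adicCompletionIntegers F) r) < 1 := by
  have hd := v.denseRange_algebraMap F
  have ho : IsOpen {y : v.adicCompletion F | Valued.v ((x : v.adicCompletion F) - y) < 1} := by
    have h1 : IsOpen {y : v.adicCompletion F | Valued.v y < 1} := by
      have h2 := Valued.isOpen_ball (v.adicCompletion F) (1 : (MonoidWithZeroHom.ofClass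
        (Valued.v : Valuation (v.adicCompletion F) (WithZero (Multiplicative ℤ)))).ValueGroup₀)
      convert h2 using 2
      ext y
      simp
    exact h1.preimage (continuous_const.sub continuous_id)
  obtain ⟨k, hk⟩ := hd.exists_mem_open ho ⟨x, by simp⟩
  have hk' : Valued.v ((x : v.adicCompletion F) - (k : v.adicCompletion F)) < 1 := hk
  have hk1 : v.valuation F k ≤ 1 := by
    rw [← v.valuedAdicCompletion_eq_valuation' k]
    have : (k : v.adicCompletion F) = x - (x - k) := by ring
    rw [this]
    exact (Valuation.map_sub _ _ _).trans (max_le x.2 hk'.le)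
  obtain ⟨r, hr⟩ := exists_valuation_sub_lt_of_integer (K := F) v hk1 1
  refine ⟨r, ?_⟩
  have : (x : v.adicCompletion F) - algebraMap (𝓞 F) (v.adicCompletionIntegers F) r =
      (x - k) - (((algebraMap (𝓞 F) F r - k : F)) : v.adicCompletion F) := by
    have h2 : ((algebraMap (𝓞 F) F r - k : F) : v.adicCompletion F) =
      ((algebraMap (𝓞 F) F r : F) : v.adicCompletion F) - (k : v.adicCompletion F) :=
      map_sub (FinitePlace.embedding v) _ _
    rw [h2]
    have h3 : ((algebraMap (𝓞 F) (v.adicCompletionIntegers F) r : v.adicCompletionIntegers F) :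
        v.adicCompletion F) = ((algebraMap (𝓞 F) F r : F) : v.adicCompletion F) := rfl
    rw [h3]; ring
  rw [this]
  refine (Valuation.map_sub _ _ _).trans_lt (max_lt hk' ?_)
  rw [v.valuedAdicCompletion_eq_valuation']
  exact hr

/-- The `v`-adic integers form a complete discrete valuation ring whose residue field is a quotient
of `𝓞 F / v`, hence finite. -/
instance compactSpace_adicCompletionIntegers (v : HeightOneSpectrum (𝓞 F)) :
    CompactSpace (v.adicCompletionIntegers F) := by
  have hfin : Finite (IsLocalRing.ResidueField (v.adicCompletionIntegers F)) := by
    have : Finite (𝓞 F ⧸ v.asIdeal) := Ideal.finiteQuotientOfFreeOfNeBot _ v.ne_bot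
    let f : 𝓞 F →+* IsLocalRing.ResidueField (v.adicCompletionIntegers F) :=
      (IsLocalRing.residue _).comp (algebraMap (𝓞 F) (v.adicCompletionIntegers F))
    have hf : ∀ a ∈ v.asIdeal, f a = 0 := by
      intro a ha
      rw [RingHom.comp_apply, IsLocalRing.residue_eq_zero_iff]
      refine (Valuation.mem_maximalIdeal_iff (v.adicCompletion F) Valued.v).2 ?_
      change Valued.v ((algebraMap (𝓞 F) F a : F) : v.adicCompletion F) < 1
      rw [v.valuedAdicCompletion_eq_valuation', valuation_lt_one_iff_mem]
      exact ha
    refine Finite.of_surjective (Ideal.Quotient.lift v.asIdeal f hf) ?_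
    apply Ideal.Quotient.lift_surjective_of_surjective
    intro y
    obtain ⟨x, rfl⟩ := IsLocalRing.residue_surjective y
    obtain ⟨r, hr⟩ := exists_integer_sub_lt_one v x
    refine ⟨r, ?_⟩
    rw [RingHom.comp_apply, eq_comm, ← sub_eq_zero, ← map_sub, IsLocalRing.residue_eq_zero_iff]
    refine (Valuation.mem_maximalIdeal_iff (v.adicCompletion F) Valued.v).2 ?_
    exact hr
  have hcl : IsClosed (v.adicCompletionIntegers F : Set (v.adicCompletion F)) :=
    Valued.isClosed_valuationSubring _
  have := (Valued.integer.compactSpace_iff_completeSpace_and_isDiscreteValuationRing_and_finite_residueField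
    (K := v.adicCompletion F)).2 ⟨hcl.completeSpace_coe,
      inferInstanceAs (IsDiscreteValuationRing (v.adicCompletionIntegers F)), hfin⟩
  exact this

variable (F) in
/-- The subset `∏ᵥ 𝓞ᵥ` of the finite adeles. -/
def integralAdeles : Set 𝔸ᶠ[F] := {x | ∀ v, x v ∈ v.adicCompletionIntegers F}

theorem isOpen_integralAdeles : IsOpen (integralAdeles F) :=
  RestrictedProduct.isOpen_forall_mem
    (R := fun v : HeightOneSpectrum (𝓞 F) => v.adicCompletion F)
    (A := fun v => (v.adicCompletionIntegers F : Set (v.adicCompletion F)))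
    fun _ => Valued.isOpen_valuationSubring _

theorem isCompact_integralAdeles : IsCompact (integralAdeles F) := by
  have : ∀ v : HeightOneSpectrum (𝓞 F),
      CompactSpace ((v.adicCompletionIntegers F : Set (v.adicCompletion F))) :=
    fun v => compactSpace_adicCompletionIntegers v
  have h := isCompact_range (RestrictedProduct.isEmbedding_structureMap
    (R := fun v : HeightOneSpectrum (𝓞 F) => v.adicCompletion F)
    (A := fun v => (v.adicCompletionIntegers F : Set (v.adicCompletion F)))
    (𝓕 := Filter.cofinite)).continuous
  rw [RestrictedProduct.range_structureMap] at h
  exact h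

theorem mul_mem_integralAdeles {x y : 𝔸ᶠ[F]} (hx : x ∈ integralAdeles F)
    (hy : y ∈ integralAdeles F) : x * y ∈ integralAdeles F :=
  fun v => mul_mem (hx v) (hy v)

theorem natCast_mem_integralAdeles (m : ℕ) : (m : 𝔸ᶠ[F]) ∈ integralAdeles F :=
  fun v => natCast_mem (v.adicCompletionIntegers F) m

theorem algebraMap_mem_adicCompletionIntegers (v : HeightOneSpectrum (𝓞 F)) (r : 𝓞 F) :
    algebraMap (𝓞 F) (v.adicCompletion F) r ∈ v.adicCompletionIntegers F :=
  coe_algebraMap_mem (𝓞 F) F v r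

theorem exists_denominator (x : 𝔸ᶠ[F]) :
    ∃ m : ℕ, m ≠ 0 ∧ (m : 𝔸ᶠ[F]) * x ∈ integralAdeles F := by
  classical
  choose b hb0 hb using fun v : HeightOneSpectrum (𝓞 F) =>
    adicCompletion.mul_nonZeroDivisor_mem_adicCompletionIntegers v (x v)
  have hfin : {v | ¬ x v ∈ v.adicCompletionIntegers F}.Finite := x.2
  set d : 𝓞 F := ∏ v ∈ hfin.toFinset, b v with hd
  have hd0 : d ≠ 0 := Finset.prod_ne_zero_iff.2 fun v _ => nonZeroDivisors.ne_zero (hb0 v)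
  refine ⟨Ideal.absNorm (Ideal.span {d}), ?_, fun v => ?_⟩
  · rw [Ne, Ideal.absNorm_eq_zero_iff, Ideal.span_singleton_eq_bot]
    exact hd0
  obtain ⟨c, hc⟩ := Ideal.mem_span_singleton.1 (Ideal.absNorm_mem (Ideal.span {d}))
  set m := Ideal.absNorm (Ideal.span {d})
  have hm : (((m : 𝔸ᶠ[F]) * x) v) = (algebraMap (𝓞 F) (v.adicCompletion F) (m : 𝓞 F)) * x v := by
    rw [map_natCast]; rfl
  rw [hm, hc]
  by_cases hv : x v ∈ v.adicCompletionIntegers F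
  · exact mul_mem (algebraMap_mem_adicCompletionIntegers v (d * c)) hv
  · rw [hd, ← Finset.mul_prod_erase _ _ (hfin.mem_toFinset.2 hv), mul_assoc, map_mul,
      mul_comm, ← mul_assoc]
    exact mul_mem (hb v) (algebraMap_mem_adicCompletionIntegers v _)

/-- Every compact set of finite adeles has a common denominator. -/
theorem exists_denominator_of_isCompact {S : Set 𝔸ᶠ[F]} (hS : IsCompact S) :
    ∃ m : ℕ, m ≠ 0 ∧ ∀ x ∈ S, (m : 𝔸ᶠ[F]) * x ∈ integralAdeles F := by
  have hmono : Monotone fun n : ℕ =>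
      {x : 𝔸ᶠ[F] | (n.factorial : 𝔸ᶠ[F]) * x ∈ integralAdeles F} := by
    intro a b hab x hx
    obtain ⟨c, hc⟩ := Nat.factorial_dvd_factorial hab
    simp only [Set.mem_ofPred_eq, hc] at hx ⊢
    rw [mul_comm a.factorial, Nat.cast_mul, mul_assoc]
    exact mul_mem_integralAdeles (natCast_mem_integralAdeles c) hx
  obtain ⟨n, hn⟩ := hS.elim_directed_cover _
    (fun n => isOpen_integralAdeles.preimage (continuous_const.mul continuous_id))
    (fun x _ => by
      obtain ⟨m, hm0, hm⟩ := exists_denominator x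
      refine Set.mem_iUnion.2 ⟨m, ?_⟩
      obtain ⟨c, hc⟩ := Nat.dvd_factorial (Nat.pos_of_ne_zero hm0) le_rfl
      change (m.factorial : 𝔸ᶠ[F]) * x ∈ integralAdeles F
      rw [hc, mul_comm m, Nat.cast_mul, mul_assoc]
      exact mul_mem_integralAdeles (natCast_mem_integralAdeles c) hm)
    (directed_of_isDirected_le hmono)
  exact ⟨n.factorial, n.factorial_ne_zero, fun x hx => hn hx⟩

end FiniteAdeles

/-! ### The class group and the unit theorem, in idelic form -/

section ClassGroup
variable {F : Type*} [Field F] [NumberField F]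

open scoped nonZeroDivisors
open FractionalIdeal

theorem count_spanSingleton (v : HeightOneSpectrum (𝓞 F)) {x : F} (hx : x ≠ 0) :
    FractionalIdeal.count F v (spanSingleton (𝓞 F)⁰ x) = -WithZero.log (v.valuation F x) := by
  classical
  obtain ⟨n, d, hd, rfl⟩ := IsFractionRing.div_surjective (A := 𝓞 F) x
  have hd0 : d ≠ 0 := nonZeroDivisors.ne_zero hd
  have hn0 : n ≠ 0 := by rintro rfl; simp at hx
  have h1 : spanSingleton (𝓞 F)⁰ (algebraMap (𝓞 F) F n / algebraMap (𝓞 F) F d) =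
      spanSingleton (𝓞 F)⁰ ((algebraMap (𝓞 F) F d)⁻¹) * ↑(Ideal.span {n} : Ideal (𝓞 F)) := by
    rw [coeIdeal_span_singleton, spanSingleton_mul_spanSingleton, div_eq_inv_mul]
  rw [count_well_defined F v (spanSingleton_ne_zero_iff.2 hx) h1, map_div₀,
    WithZero.log_div (by simpa using hn0) (by simpa using hd0), valuation_of_algebraMap,
    valuation_of_algebraMap, intValuation_if_neg _ hn0, intValuation_if_neg _ hd0]
  simp only [WithZero.log_exp]
  ring

/-- The fractional ideal of a finite idele. The product is finite for units of the finite adele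
ring; elsewhere the value has no meaning. -/
noncomputable def ideleIdeal (u : 𝔸ᶠ[F]) : FractionalIdeal (𝓞 F)⁰ F :=
  ∏ᶠ v : HeightOneSpectrum (𝓞 F),
    (v.asIdeal : FractionalIdeal (𝓞 F)⁰ F) ^ (-WithZero.log (Valued.v (u v)))

theorem count_ideleIdeal {u : 𝔸ᶠ[F]} (hu : IsUnit u) (v : HeightOneSpectrum (𝓞 F)) :
    FractionalIdeal.count F v (ideleIdeal u) = -WithZero.log (Valued.v (u v)) := by
  refine count_finprod F v _ ?_
  filter_upwards [(FiniteAdeleRing.isUnit_iff.1 hu).2] with w hw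
  rw [hw, WithZero.log_one, neg_zero]

theorem ideleIdeal_ne_zero (u : 𝔸ᶠ[F]) : ideleIdeal u ≠ 0 := by
  refine finprod_induction (p := fun I : FractionalIdeal (𝓞 F)⁰ F => I ≠ 0) one_ne_zero
    (fun _ _ => mul_ne_zero) fun v => zpow_ne_zero _ ?_
  exact coeIdeal_ne_zero.mpr v.ne_bot

/-- Two finite ideles whose ideals lie in the same class differ by an element of `Fˣ` and a finite
idele that is a unit at every place. -/
theorem exists_valuation_mul_eq {u u' : 𝔸ᶠ[F]} (hu : IsUnit u) (hu' : IsUnit u')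
    (h : ClassGroup.mk F (Units.mk0 _ (ideleIdeal_ne_zero u)) =
      ClassGroup.mk F (Units.mk0 _ (ideleIdeal_ne_zero u'))) :
    ∃ a : Fˣ, ∀ v : HeightOneSpectrum (𝓞 F),
      v.valuation F (a : F) * Valued.v (u v) = Valued.v (u' v) := by
  rw [eq_comm, ← mul_inv_eq_one, ← map_inv, ← map_mul, ClassGroup.mk_eq_one_iff,
    FractionalIdeal.isPrincipal_iff] at h
  obtain ⟨x, hx⟩ := h
  rw [Units.val_mul, Units.val_inv_eq_inv_val, Units.val_mk0, Units.val_mk0] at hx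
  have hx0 : x ≠ 0 := by
    rintro rfl
    rw [spanSingleton_zero] at hx
    exact mul_ne_zero (ideleIdeal_ne_zero u') (inv_ne_zero (ideleIdeal_ne_zero u)) hx
  refine ⟨Units.mk0 x hx0, fun v => ?_⟩
  have h1 := congrArg (FractionalIdeal.count F v) hx
  rw [FractionalIdeal.count_mul F v (ideleIdeal_ne_zero u') (inv_ne_zero (ideleIdeal_ne_zero u)),
    FractionalIdeal.count_inv, count_ideleIdeal hu, count_ideleIdeal hu',
    count_spanSingleton v hx0] at h1
  have hu0 : Valued.v (u v) ≠ 0 :=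
    (Valuation.ne_zero_iff _).2 ((FiniteAdeleRing.isUnit_iff.1 hu).1 v)
  have hu0' : Valued.v (u' v) ≠ 0 :=
    (Valuation.ne_zero_iff _).2 ((FiniteAdeleRing.isUnit_iff.1 hu').1 v)
  have hx0' : v.valuation F x ≠ 0 := (Valuation.ne_zero_iff _).2 hx0
  rw [Units.val_mk0, ← WithZero.exp_log hu0', ← WithZero.exp_log (mul_ne_zero hx0' hu0),
    WithZero.log_mul hx0' hu0]
  congr 1
  linarith

/-- Finiteness of the class group: up to `Fˣ` and the units at all finite places there are finitely
many finite ideles. -/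
theorem exists_finite_representatives :
    ∃ T : Set 𝔸ᶠ[F], T.Finite ∧ (∀ u ∈ T, IsUnit u) ∧ ∀ u : 𝔸ᶠ[F], IsUnit u →
      ∃ u' ∈ T, ∃ a : Fˣ, ∀ v : HeightOneSpectrum (𝓞 F),
        v.valuation F (a : F) * Valued.v (u v) = Valued.v (u' v) := by
  let c : 𝔸ᶠ[F] → ClassGroup (𝓞 F) := fun u =>
    ClassGroup.mk F (Units.mk0 _ (ideleIdeal_ne_zero u))
  obtain ⟨T, hT, hT', hT''⟩ : ∃ T : Set 𝔸ᶠ[F], T ⊆ {u | IsUnit u} ∧ T.Finite ∧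
      c '' T = c '' {u | IsUnit u} := by
    obtain ⟨T, hT, hT'⟩ := Set.exists_subset_bijOn {u | IsUnit u} c
    exact ⟨T, hT, Set.Finite.of_finite_image (Set.toFinite _) hT'.injOn, hT'.image_eq⟩
  refine ⟨T, hT', hT, fun u hu => ?_⟩
  obtain ⟨u', hu', h⟩ : c u ∈ c '' T := hT'' ▸ ⟨u, hu, rfl⟩
  exact ⟨u', hu', exists_valuation_mul_eq hu (hT hu') h.symm⟩

end ClassGroup

section Units
variable {F : Type*} [Field F] [NumberField F]

open mixedEmbedding

/-- Dirichlet's unit theorem: multiplying by a unit, the absolute values at the infinite places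
can be made equal up to a bounded factor. -/
theorem exists_unit_abs_log_sub_le (F : Type*) [Field F] [NumberField F] :
    ∃ C : ℝ, ∀ r : InfinitePlace F → ℝ, (∀ w, 0 < r w) →
      ∃ (ε : (𝓞 F)ˣ) (l : ℝ), ∀ w : InfinitePlace F,
        |Real.log (w (ε : F) * r w) - l| ≤ C := by
  classical
  have hb := ZSpan.fundamentalDomain_isBounded
    ((Units.basisUnitLattice F).ofZLatticeBasis ℝ (Units.unitLattice F))
  obtain ⟨C, hC⟩ := hb.exists_norm_le
  refine ⟨max C (Fintype.card (InfinitePlace F) * C), fun r hr => ?_⟩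
  -- a point of the mixed space with absolute value `r w` at each `w`
  let x : mixedSpace F := (fun w => r w.1, fun w => (r w.1 : ℂ))
  have hx : ∀ w, normAtPlace w x = r w := by
    intro w
    rcases w.isReal_or_isComplex with hw | hw
    · rw [normAtPlace_apply_of_isReal hw]
      simp [x, abs_of_pos (hr w)]
    · rw [normAtPlace_apply_of_isComplex hw]
      simp [x, abs_of_pos (hr w)]
  have hxn : mixedEmbedding.norm x ≠ 0 :=
    mixedEmbedding.norm_ne_zero_iff.2 fun w => by rw [hx]; exact (hr w).ne'
  obtain ⟨ε, hε⟩ := fundamentalCone.exists_unit_smul_mem hxn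
  set y := ε • x with hy
  have hyw : ∀ w, normAtPlace w y = w (ε : F) * r w := by
    intro w
    rw [hy, unitSMul_smul, map_mul, normAtPlace_apply, hx]
  set l := Real.log (mixedEmbedding.norm y) * (Module.finrank ℚ F : ℝ)⁻¹ with hl
  have hC0 : 0 ≤ C := (norm_nonneg _).trans (hC _ hε.1)
  have h1 : ∀ w : {w : InfinitePlace F // w ≠ Units.dirichletUnitTheorem.w₀},
      |(w.1.mult : ℝ) * (Real.log (normAtPlace w.1 y) - l)| ≤ C := by
    intro w
    exact (norm_le_pi_norm (logMap y) w).trans (hC _ hε.1)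
  have hpos : ∀ w, 0 < normAtPlace w y := fundamentalCone.normAtPlace_pos_of_mem hε
  -- the weighted logarithms sum to zero, which bounds the one at the omitted place
  have hsum : ∑ w : InfinitePlace F, (w.mult : ℝ) * (Real.log (normAtPlace w y) - l) = 0 := by
    simp only [mul_sub, Finset.sum_sub_distrib]
    rw [← Finset.sum_mul, ← Nat.cast_sum, InfinitePlace.sum_mult_eq, hl, mixedEmbedding.norm_apply,
      Real.log_prod (fun w _ => (pow_pos (hpos w) _).ne')]
    simp only [Real.log_pow]
    have : (Module.finrank ℚ F : ℝ) ≠ 0 := Nat.cast_ne_zero.2 Module.finrank_pos.ne'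
    field_simp
    ring
  have h2 : ∀ w : InfinitePlace F, |(w.mult : ℝ) * (Real.log (normAtPlace w y) - l)| ≤
      max C (Fintype.card (InfinitePlace F) * C) := by
    intro w
    by_cases hw : w = Units.dirichletUnitTheorem.w₀
    · refine le_max_of_le_right ?_
      rw [← Finset.add_sum_erase _ _ (Finset.mem_univ w), add_eq_zero_iff_eq_neg] at hsum
      rw [hsum, abs_neg]
      refine (Finset.abs_sum_le_sum_abs _ _).trans ?_
      refine (Finset.sum_le_card_nsmul _ _ C fun z hz => h1 ⟨z, ?_⟩).trans ?_
      · rw [← hw]; exact Finset.ne_of_mem_erase hz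
      · rw [nsmul_eq_mul]
        gcongr
        exact Finset.card_le_univ _
    · exact le_max_of_le_left (h1 ⟨w, hw⟩)
  refine ⟨ε, l, fun w => ?_⟩
  rw [← hyw]
  refine le_trans ?_ (h2 w)
  rw [abs_mul]
  refine le_mul_of_one_le_left (abs_nonneg _) ?_
  rw [Nat.abs_cast]
  exact_mod_cast InfinitePlace.mult_pos
end Units

/-! ### Components of an adele and compact sets of ideles -/

section Components
variable {F : Type*} [Field F] [NumberField F]

/-- The component of an adele at an infinite place, as a ring homomorphism. -/
def archEval (w : InfinitePlace F) : 𝔸[F] →+* w.Completion where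
  toFun x := x.1 w
  map_one' := rfl
  map_mul' _ _ := rfl
  map_zero' := rfl
  map_add' _ _ := rfl

/-- The projection of an adele to the finite adeles, as a ring homomorphism. -/
def finitePart : 𝔸[F] →+* 𝔸ᶠ[F] where
  toFun x := x.2
  map_one' := rfl
  map_mul' _ _ := rfl
  map_zero' := rfl
  map_add' _ _ := rfl

theorem continuous_archEval (w : InfinitePlace F) : Continuous (archEval w : 𝔸[F] → w.Completion) :=
  (continuous_apply w).comp continuous_fst

theorem continuous_finitePart : Continuous (finitePart : 𝔸[F] → 𝔸ᶠ[F]) := continuous_snd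

theorem norm_archEval_algebraMap (w : InfinitePlace F) (x : F) :
    ‖archEval w (algebraMap F 𝔸[F] x)‖ = w x :=
  InfinitePlace.Completion.norm_coe w (WithAbs.toAbs w.1 x)

instance : T2Space 𝔸[F] := by
  have : T2Space (InfiniteAdeleRing F) :=
    inferInstanceAs (T2Space ((v : InfinitePlace F) → v.Completion))
  have : T2Space 𝔸ᶠ[F] := inferInstanceAs (T2Space
    (RestrictedProduct (fun v : HeightOneSpectrum (𝓞 F) => v.adicCompletion F)
    (fun v => (v.adicCompletionIntegers F : Set (v.adicCompletion F))) Filter.cofinite))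
  exact inferInstanceAs (T2Space (InfiniteAdeleRing F × 𝔸ᶠ[F]))

variable (F) in
theorem countable_numberField : Countable F :=
  (Module.finBasis ℚ F).equivFun.injective.countable

variable (F) in
/-- The idele equal to `2` at all infinite places and to `1` at all finite places. -/
noncomputable def archTwo : (𝔸[F])ˣ where
  val := (algebraMap F (InfiniteAdeleRing F) 2, 1)
  inv := (algebraMap F (InfiniteAdeleRing F) 2⁻¹, 1)
  val_inv := by
    refine Prod.ext ?_ (mul_one _)
    change algebraMap F (InfiniteAdeleRing F) 2 * algebraMap F (InfiniteAdeleRing F) 2⁻¹ = 1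
    rw [← map_mul, mul_inv_cancel₀ two_ne_zero, map_one]
  inv_val := by
    refine Prod.ext ?_ (mul_one _)
    change algebraMap F (InfiniteAdeleRing F) 2⁻¹ * algebraMap F (InfiniteAdeleRing F) 2 = 1
    rw [← map_mul, inv_mul_cancel₀ two_ne_zero, map_one]

theorem archEval_archTwo_zpow (w : InfinitePlace F) (n : ℤ) :
    archEval w ((archTwo F ^ n : (𝔸[F])ˣ) : 𝔸[F]) = (((2 : F) ^ n : F) : w.Completion) := by
  have h : Units.map (archEval w).toMonoidHom (archTwo F) =
      Units.map (algebraMap F w.Completion).toMonoidHom (Units.mk0 (2 : F) two_ne_zero) := by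
    ext1
    rfl
  have h2 := congrArg Units.val (map_zpow (Units.map (archEval w).toMonoidHom) (archTwo F) n)
  rw [h, ← map_zpow] at h2
  refine h2.trans ?_
  rw [Units.coe_map, Units.val_zpow_eq_zpow_val]
  rfl

theorem norm_archEval_archTwo_zpow (w : InfinitePlace F) (n : ℤ) :
    ‖archEval w ((archTwo F ^ n : (𝔸[F])ˣ) : 𝔸[F])‖ = 2 ^ n := by
  have h2 : w (2 : F) = 2 := by
    refine (w.norm_embedding_eq 2).symm.trans ?_
    rw [map_ofNat]
    exact RCLike.norm_ofNat 2
  rw [archEval_archTwo_zpow]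
  refine (InfinitePlace.Completion.norm_coe w _).trans ?_
  refine (map_zpow₀ w (2 : F) n).trans ?_
  rw [h2]

theorem finitePart_archTwo_zpow (n : ℤ) :
    finitePart ((archTwo F ^ n : (𝔸[F])ˣ) : 𝔸[F]) = 1 := by
  have h : Units.map (finitePart (F := F)).toMonoidHom (archTwo F) = 1 := by
    ext1
    rfl
  have h2 := congrArg Units.val (map_zpow (Units.map (finitePart (F := F)).toMonoidHom)
    (archTwo F) n)
  rw [h, one_zpow] at h2
  exact h2

theorem archEval_ne_zero (t : (𝔸[F])ˣ) (w : InfinitePlace F) : archEval w (t : 𝔸[F]) ≠ 0 :=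
  (t.isUnit.map (archEval w)).ne_zero

theorem isUnit_finitePart (t : (𝔸[F])ˣ) : IsUnit (finitePart (t : 𝔸[F])) :=
  t.isUnit.map finitePart

/-- The adeles bounded by `R` at the infinite places whose finite part lies in one of the
lattices `u · ∏ᵥ 𝓞ᵥ`, `u ∈ T`. -/
def adeleBox (R : ℝ) (T : Set 𝔸ᶠ[F]) : Set 𝔸[F] :=
  {x | (∀ w, ‖archEval w x‖ ≤ R) ∧ ∃ u ∈ T, ∃ y ∈ integralAdeles F, finitePart x = u * y}

omit [NumberField F] in
theorem isCompact_closedBall_completion (w : InfinitePlace F) (R : ℝ) :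
    IsCompact {x : w.Completion | ‖x‖ ≤ R} := by
  have h := (InfinitePlace.Completion.isometry_extensionEmbedding w)
  have h2 := h.isClosedEmbedding.isCompact_preimage (isCompact_closedBall (0 : ℂ) R)
  convert h2 using 1
  ext x
  simp only [Set.mem_ofPred_eq, Set.mem_preimage, mem_closedBall_zero_iff]
  rw [h.norm_map_of_map_zero (map_zero _)]

theorem isCompact_adeleBox (R : ℝ) {T : Set 𝔸ᶠ[F]} (hT : T.Finite) :
    IsCompact (adeleBox R T) := by
  have h1 : IsCompact (Set.pi Set.univ fun w : InfinitePlace F => {x : w.Completion | ‖x‖ ≤ R}) :=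
    isCompact_univ_pi fun w => isCompact_closedBall_completion w R
  have h2 : IsCompact (⋃ u ∈ T, (fun y => u * y) '' integralAdeles F) :=
    hT.isCompact_biUnion fun u _ =>
      isCompact_integralAdeles.image (continuous_const.mul continuous_id)
  have h3 := h1.prod h2
  refine (show adeleBox R T = _ from ?_) ▸ h3
  refine Set.ext fun x => ⟨fun ⟨h1, u, hu, y, hy, h⟩ => ?_, fun ⟨h1, h2⟩ => ?_⟩
  · exact ⟨fun w _ => h1 w, Set.mem_biUnion hu ⟨y, hy, h.symm⟩⟩
  · obtain ⟨u, hu, y, hy, h⟩ := Set.mem_iUnion₂.1 h2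
    exact ⟨fun w => h1 w trivial, u, hu, y, hy, h.symm⟩

/-- The ideles carry the topology induced from the closed embedding `t ↦ (t, t⁻¹)`. -/
theorem isCompact_units_preimage {C : Set 𝔸[F]} (hC : IsCompact C) :
    IsCompact {t : (𝔸[F])ˣ | (t : 𝔸[F]) ∈ C ∧ ((t⁻¹ : (𝔸[F])ˣ) : 𝔸[F]) ∈ C} :=
  Units.isClosedEmbedding_embedProduct.isCompact_preimage
    (hC.prod ((MulOpposite.opHomeomorph (M := 𝔸[F])).symm.isCompact_preimage.2 hC))

end Components

/-! ### The principal ideles: cocompactness modulo dilations, and discreteness -/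

section Reduction
variable {F : Type*} [Field F] [NumberField F]

theorem valuation_unit (v : HeightOneSpectrum (𝓞 F)) (ε : (𝓞 F)ˣ) :
    v.valuation F ((ε : 𝓞 F) : F) = 1 := by
  refine (valuation_eq_one_iff_notMem (K := F) v).2 fun h => ?_
  exact v.isPrime.ne_top (Ideal.eq_top_of_isUnit_mem _ h ε.isUnit)

theorem mem_adeleBox_of_valued_eq {R : ℝ} {T : Set 𝔸ᶠ[F]} {x : 𝔸[F]}
    (hx : ∀ w, ‖archEval w x‖ ≤ R) (u : (𝔸ᶠ[F])ˣ) (hu : (u : 𝔸ᶠ[F]) ∈ T)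
    (h : ∀ v, Valued.v ((finitePart x) v) = Valued.v ((u : 𝔸ᶠ[F]) v)) : x ∈ adeleBox R T := by
  refine ⟨hx, u, hu, ((u⁻¹ : (𝔸ᶠ[F])ˣ) : 𝔸ᶠ[F]) * finitePart x, fun v => ?_, ?_⟩
  · have h1 : ((u⁻¹ : (𝔸ᶠ[F])ˣ) : 𝔸ᶠ[F]) v * (u : 𝔸ᶠ[F]) v = 1 :=
      congrArg (fun y : 𝔸ᶠ[F] => y v) u.inv_mul
    change Valued.v (((u⁻¹ : (𝔸ᶠ[F])ˣ) : 𝔸ᶠ[F]) v * (finitePart x) v) ≤ 1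
    rw [map_mul, h, ← map_mul, h1, map_one]
  · rw [← mul_assoc, u.mul_inv, one_mul]

/-- The idele class group modulo the subgroup generated by `archTwo` is compact: this combines
the finiteness of the class group and Dirichlet's unit theorem. -/
theorem exists_isCompact_principalIdele_mul_archTwo_zpow_mul (F : Type*) [Field F] [NumberField F] :
    ∃ K : Set (𝔸[F])ˣ, IsCompact K ∧ ∀ t : (𝔸[F])ˣ,
      ∃ (a : Fˣ) (n : ℤ), ∃ k ∈ K, t = principalIdele F a * (archTwo F ^ n * k) := by
  obtain ⟨T, hTfin, hTu, hT⟩ := exists_finite_representatives (F := F)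
  obtain ⟨C, hC⟩ := exists_unit_abs_log_sub_le F
  set R := Real.exp (C + Real.log 2) with hR
  set T' : Set 𝔸ᶠ[F] := T ∪ Ring.inverse '' T
  refine ⟨_, isCompact_units_preimage (isCompact_adeleBox R (T := T')
    (hTfin.union (hTfin.image _))), fun t => ?_⟩
  obtain ⟨u', hu', a₀, ha₀⟩ := hT _ (isUnit_finitePart t)
  obtain ⟨u, rfl⟩ := hTu u' hu'
  obtain ⟨ε, l, hl⟩ := hC (fun w => w (a₀ : F) * ‖archEval w (t : 𝔸[F])‖) fun w =>
    mul_pos (InfinitePlace.pos_iff.2 a₀.ne_zero) (norm_pos_iff.2 (archEval_ne_zero t w))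
  have hlog2 : 0 < Real.log 2 := Real.log_pos one_lt_two
  -- `2 ^ n` is the common size `exp l` of the archimedean components, up to a factor of `2`
  set n : ℤ := ⌊l / Real.log 2⌋ with hn
  have hn1 : |l - n * Real.log 2| ≤ Real.log 2 := by
    have h1 := Int.floor_le (l / Real.log 2)
    have h2 := Int.lt_floor_add_one (l / Real.log 2)
    rw [le_div_iff₀ hlog2] at h1
    rw [div_lt_iff₀ hlog2] at h2
    rw [abs_le]
    constructor <;> linarith
  let e : Fˣ := Units.map (algebraMap (𝓞 F) F).toMonoidHom ε
  set k : (𝔸[F])ˣ := archTwo F ^ (-n) * (principalIdele F (e * a₀) * t) with hk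
  have harch : ∀ w, ‖archEval w (k : 𝔸[F])‖ =
      2 ^ (-n) * (w (ε : F) * (w (a₀ : F) * ‖archEval w (t : 𝔸[F])‖)) := by
    intro w
    rw [hk, Units.val_mul, map_mul, norm_mul, norm_archEval_archTwo_zpow, Units.val_mul, map_mul,
      norm_mul, ← mul_assoc (w (ε : F)), ← map_mul w]
    congr 2
    exact norm_archEval_algebraMap w _
  have hpos : ∀ w, 0 < ‖archEval w (k : 𝔸[F])‖ := fun w => norm_pos_iff.2 (archEval_ne_zero k w)
  have hlogk : ∀ w, |Real.log ‖archEval w (k : 𝔸[F])‖| ≤ C + Real.log 2 := by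
    intro w
    have h0 : (w (ε : F) * (w (a₀ : F) * ‖archEval w (t : 𝔸[F])‖)) ≠ 0 := by
      intro h
      have := hpos w
      rw [harch, h, mul_zero] at this
      exact this.false
    rw [harch, Real.log_mul (by positivity) h0, Real.log_zpow]
    calc |((-n : ℤ) : ℝ) * Real.log 2 +
          Real.log (w (ε : F) * (w (a₀ : F) * ‖archEval w (t : 𝔸[F])‖))|
        = |(Real.log (w (ε : F) * (w (a₀ : F) * ‖archEval w (t : 𝔸[F])‖)) - l)
            + (l - n * Real.log 2)| := by
          congr 1
          push_cast
          ring
      _ ≤ _ := (abs_add_le _ _).trans (add_le_add (hl w) hn1)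
  have hfin : ∀ v, Valued.v ((finitePart (k : 𝔸[F])) v) = Valued.v ((u : 𝔸ᶠ[F]) v) := by
    intro v
    rw [← ha₀ v, hk, Units.val_mul, map_mul, finitePart_archTwo_zpow, one_mul, Units.val_mul,
      map_mul]
    have h1 : ((finitePart ((principalIdele F (e * a₀) : (𝔸[F])ˣ) : 𝔸[F])) *
      finitePart (t : 𝔸[F])) v = (((e * a₀ : Fˣ) : F) : v.adicCompletion F) *
        (finitePart (t : 𝔸[F])) v := rfl
    rw [h1, map_mul, v.valuedAdicCompletion_eq_valuation', Units.val_mul, map_mul]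
    have h2 : v.valuation F ((e : Fˣ) : F) = 1 := valuation_unit v ε
    rw [h2, one_mul]
  refine ⟨(e * a₀)⁻¹, n, k, ⟨?_, ?_⟩, ?_⟩
  · refine mem_adeleBox_of_valued_eq (fun w => ?_) u (Or.inl hu') hfin
    rw [hR, ← Real.log_le_iff_le_exp (hpos w)]
    exact (le_abs_self _).trans (hlogk w)
  · refine mem_adeleBox_of_valued_eq (fun w => ?_) u⁻¹
      (Or.inr ⟨u, hu', Ring.inverse_unit u⟩) fun v => ?_
    · have h1 : archEval w (k : 𝔸[F]) * archEval w ((k⁻¹ : (𝔸[F])ˣ) : 𝔸[F]) = 1 := by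
        rw [← map_mul, k.mul_inv, map_one]
      have h2 : ‖archEval w ((k⁻¹ : (𝔸[F])ˣ) : 𝔸[F])‖ = ‖archEval w (k : 𝔸[F])‖⁻¹ := by
        rw [eq_inv_of_mul_eq_one_right h1, norm_inv]
      rw [h2, hR, ← Real.log_le_iff_le_exp (inv_pos.2 (hpos w)), Real.log_inv]
      exact (neg_le_abs _).trans (hlogk w)
    · have h1 : (finitePart (k : 𝔸[F])) v * (finitePart ((k⁻¹ : (𝔸[F])ˣ) : 𝔸[F])) v = 1 :=
        congrArg (fun y : 𝔸[F] => (finitePart y) v) k.mul_inv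
      have h2 : (u : 𝔸ᶠ[F]) v * ((u⁻¹ : (𝔸ᶠ[F])ˣ) : 𝔸ᶠ[F]) v = 1 :=
        congrArg (fun y : 𝔸ᶠ[F] => y v) u.mul_inv
      have h1' := congrArg Valued.v h1
      have h2' := congrArg Valued.v h2
      rw [map_mul, map_one] at h1' h2'
      rw [hfin] at h1'
      rw [eq_inv_of_mul_eq_one_right h1', eq_inv_of_mul_eq_one_right h2']
  · rw [hk, map_inv, zpow_neg]
    group

/-- The principal ideles are discrete: a nonzero integer of `F` cannot have all its archimedean
absolute values less than `1`. -/
theorem exists_nhds_one_principalIdele_eq_one (F : Type*) [Field F] [NumberField F] :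
    ∃ U : Set (𝔸[F])ˣ, IsOpen U ∧ 1 ∈ U ∧ ∀ a : Fˣ, principalIdele F a ∈ U → a = 1 := by
  refine ⟨{t | (∀ w, ‖archEval w (t : 𝔸[F]) - 1‖ < 1) ∧ finitePart (t : 𝔸[F]) ∈ integralAdeles F},
    ?_, ?_, ?_⟩
  · refine IsOpen.inter ?_ (isOpen_integralAdeles.preimage
      (continuous_finitePart.comp Units.continuous_val))
    have h1 : IsOpen (⋂ w, {t : (𝔸[F])ˣ | ‖archEval w (t : 𝔸[F]) - 1‖ < 1}) :=
      isOpen_iInter_of_finite fun w => isOpen_lt (((continuous_archEval w).comp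
        Units.continuous_val).sub continuous_const).norm continuous_const
    rwa [show (⋂ w, {t : (𝔸[F])ˣ | ‖archEval w (t : 𝔸[F]) - 1‖ < 1}) =
      {t : (𝔸[F])ˣ | ∀ w, ‖archEval w (t : 𝔸[F]) - 1‖ < 1} from
        Set.ext fun t => Set.mem_iInter] at h1
  · refine ⟨fun w => ?_, fun v => ?_⟩
    · rw [Units.val_one, map_one, sub_self, norm_zero]
      exact one_pos
    · exact (v.adicCompletionIntegers F).one_mem
  · rintro a ⟨h1, h2⟩
    by_contra hne
    have hint : ∀ v : HeightOneSpectrum (𝓞 F), v.valuation F (a : F) ≤ 1 := by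
      intro v
      rw [← v.valuedAdicCompletion_eq_valuation']
      exact h2 v
    obtain ⟨r, hr⟩ := mem_integers_of_valuation_le_one F (a : F) hint
    have hr0 : r - 1 ≠ 0 := by
      intro h
      rw [sub_eq_zero] at h
      rw [h, map_one] at hr
      exact hne (Units.ext hr.symm)
    have hw : ∀ w : InfinitePlace F, w ((r - 1 : 𝓞 F) : F) < 1 := by
      intro w
      have h3 := h1 w
      have h4 : archEval w ((principalIdele F a : (𝔸[F])ˣ) : 𝔸[F]) - 1 =
          archEval w (algebraMap F 𝔸[F] (a - 1)) := by
        rw [map_sub, map_sub, map_one, map_one]; rfl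
      rw [h4, norm_archEval_algebraMap, ← hr] at h3
      have h5 : ((r - 1 : 𝓞 F) : F) = algebraMap (𝓞 F) F r - 1 :=
        (map_sub (algebraMap (𝓞 F) F) r 1).trans (by rw [map_one])
      rwa [h5]
    obtain ⟨w⟩ := (inferInstance : Nonempty (InfinitePlace F))
    exact (InfinitePlace.one_le_of_lt_one hr0 (w := w) fun z _ => hw z).not_gt (hw w)

theorem principalIdele_injective : Function.Injective (principalIdele F) :=
  Units.map_injective (AdeleRing.algebraMap_injective (𝓞 F) F)

end Reduction

/-! ### Fundamental domains -/

section FundamentalDomain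

open scoped Pointwise Topology

/-- A countable discrete subgroup of a Lindelöf topological group has a Borel fundamental
domain. -/
theorem exists_isFundamentalDomain_of_discrete {G : Type*} [Group G] [TopologicalSpace G]
    [IsTopologicalGroup G] [LindelofSpace G] [MeasurableSpace G] [BorelSpace G] (μ : Measure G)
    (Γ : Subgroup G) [Countable Γ] {V : Set G} (hV : V ∈ 𝓝 (1 : G))
    (hΓ : ∀ γ ∈ Γ, γ ∈ V → γ = 1) :
    ∃ D : Set G, MeasurableSet D ∧ IsFundamentalDomain Γ.op D μ := by
  classical
  obtain ⟨W, hWo, hW1, hW⟩ : ∃ W : Set G, IsOpen W ∧ 1 ∈ W ∧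
      ∀ x ∈ W, ∀ y ∈ W, x⁻¹ * y ∈ V := by
    have hc : Filter.Tendsto (fun p : G × G => p.1⁻¹ * p.2) (𝓝 (1, 1)) (𝓝 1) := by
      have : Continuous fun p : G × G => p.1⁻¹ * p.2 := by fun_prop
      simpa using this.tendsto (1, 1)
    have hm := hc hV
    rw [nhds_prod_eq] at hm
    obtain ⟨W, ⟨h1, h2⟩, h3⟩ := (nhds_basis_opens (1 : G)).prod_self.mem_iff.1 hm
    exact ⟨W, h2, h1, fun x hx y hy => h3 (Set.mk_mem_prod hx hy)⟩
  obtain ⟨s, hs, hs'⟩ := LindelofSpace.elim_nhds_subcover (fun x : G => (fun y => x⁻¹ * y) ⁻¹' W)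
    fun x => (hWo.preimage (continuous_const.mul continuous_id)).mem_nhds (by simpa using hW1)
  have hsne : s.Nonempty := by
    by_contra h
    rw [Set.not_nonempty_iff_eq_empty] at h
    have : (1 : G) ∈ (Set.univ : Set G) := trivial
    simp [← hs', h] at this
  obtain ⟨x, rfl⟩ := hs.exists_eq_range hsne
  let A : ℕ → Set G := fun n => (fun y => (x n)⁻¹ * y) ⁻¹' W
  have hA : ∀ n, IsOpen (A n) := fun n => hWo.preimage (continuous_const.mul continuous_id)
  let S : ℕ → Set G := fun n => ⋃ γ : Γ, (fun y => y * (γ : G)) ⁻¹' A n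
  have hS : ∀ n, IsOpen (S n) := fun n =>
    isOpen_iUnion fun γ => (hA n).preimage (continuous_id.mul continuous_const)
  have hSinv : ∀ n (t : G) (γ : Γ), t * γ ∈ S n → t ∈ S n := by
    intro n t γ h
    obtain ⟨δ, hδ⟩ := Set.mem_iUnion.1 h
    refine Set.mem_iUnion.2 ⟨γ * δ, ?_⟩
    simpa [mul_assoc] using hδ
  have hAS : ∀ n (t : G) (γ : Γ), t * γ ∈ A n → t ∈ S n := fun n t γ h => Set.mem_iUnion.2 ⟨γ, h⟩
  -- `A n` meets each coset of `Γ` in at most one point; `D` takes that point from the first `A n`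
  -- that meets the coset
  let D : Set G := ⋃ n, A n \ ⋃ m < n, S m
  have hD : MeasurableSet D := MeasurableSet.iUnion fun n => (hA n).measurableSet.diff <|
    MeasurableSet.iUnion fun m => MeasurableSet.iUnion fun _ => (hS m).measurableSet
  refine ⟨D, hD, IsFundamentalDomain.mk' hD.nullMeasurableSet fun t => ?_⟩
  have hex : ∃ n, t ∈ S n := by
    have : t ∈ (Set.univ : Set G) := trivial
    rw [← hs'] at this
    obtain ⟨_, ⟨n, rfl⟩, h⟩ := Set.mem_iUnion₂.1 this
    exact ⟨n, hAS n t 1 (by simpa [A] using h)⟩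
  obtain ⟨γ, hγ⟩ := Set.mem_iUnion.1 (Nat.find_spec hex)
  have key : ∀ δ : Γ, t * δ ∈ D → t * δ ∈ A (Nat.find hex) := by
    intro δ hδ
    obtain ⟨n, hn1, hn2⟩ := Set.mem_iUnion.1 hδ
    have hle : Nat.find hex ≤ n := Nat.find_min' hex (hAS n t δ hn1)
    rcases hle.eq_or_lt with h | h
    · rwa [h]
    · exact (hn2 (Set.mem_iUnion₂.2 ⟨Nat.find hex, h,
        hAS _ (t * δ) (δ⁻¹ * γ) (by simpa [mul_assoc] using hγ)⟩)).elim
  refine ⟨⟨MulOpposite.op (γ : G), γ.2⟩, ?_, ?_⟩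
  · refine Set.mem_iUnion.2 ⟨Nat.find hex, hγ, fun h => ?_⟩
    obtain ⟨m, hm, h⟩ := Set.mem_iUnion₂.1 h
    exact Nat.find_min hex hm (hSinv m t γ h)
  · rintro ⟨δ, hδ⟩ h
    have h1 := key ⟨MulOpposite.unop δ, hδ⟩ h
    have h2 := hW _ hγ _ h1
    have h3 := hΓ (((γ : G))⁻¹ * MulOpposite.unop δ) (Γ.mul_mem (Γ.inv_mem γ.2) hδ)
      (by simpa [mul_assoc] using h2)
    refine Subtype.ext (MulOpposite.unop_injective ?_)
    exact (inv_mul_eq_one.1 h3).symm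

end FundamentalDomain

section Ideles
variable {F : Type*} [Field F] [NumberField F]

instance : Countable (principalIdeles F) := by
  have := countable_numberField F
  have : Countable Fˣ := Units.val_injective.countable
  exact Set.countable_range (principalIdele F)

instance : SigmaCompactSpace (𝔸[F])ˣ := by
  obtain ⟨K, hK, hK'⟩ := exists_isCompact_principalIdele_mul_archTwo_zpow_mul F
  have := countable_numberField F
  have : Countable Fˣ := Units.val_injective.countable
  refine isSigmaCompact_univ_iff.1 ?_
  have h : (Set.univ : Set (𝔸[F])ˣ) =
      ⋃ p : Fˣ × ℤ, (fun k => principalIdele F p.1 * (archTwo F ^ p.2 * k)) '' K := by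
    refine (Set.eq_univ_of_forall fun t => ?_).symm
    obtain ⟨a, n, k, hk, h⟩ := hK' t
    exact Set.mem_iUnion.2 ⟨(a, n), k, hk, h.symm⟩
  rw [h]
  exact isSigmaCompact_iUnion_of_isCompact _ fun p => hK.image (by fun_prop)

theorem exists_isFundamentalDomain_principalIdeles (μ : Measure (𝔸[F])ˣ) :
    ∃ D : Set (𝔸[F])ˣ, MeasurableSet D ∧ IsFundamentalDomain (principalIdeles F).op D μ := by
  obtain ⟨U, hU, h1, h⟩ := exists_nhds_one_principalIdele_eq_one F
  refine exists_isFundamentalDomain_of_discrete μ (principalIdeles F) (hU.mem_nhds h1) ?_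
  rintro _ ⟨a, rfl⟩ ha
  rw [h a ha, map_one]

end Ideles

/-! ### Lattice sums -/

section Theta
variable {F : Type*} [Field F] [NumberField F]

/-- The vectors of `F²` both of whose coordinates have denominator dividing `m`. -/
def denominatorLattice (F : Type*) [Field F] (m : ℕ) : Set (Fin 2 → F) :=
  {v | ∀ i, ∃ r : 𝓞 F, (r : F) = m * v i}

omit [NumberField F] in
theorem denominatorLattice_mono {m n : ℕ} (h : m ∣ n) :
    denominatorLattice F m ⊆ denominatorLattice F n := by
  obtain ⟨c, rfl⟩ := h
  intro v hv i
  obtain ⟨r, hr⟩ := hv i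
  refine ⟨c * r, ?_⟩
  refine (map_mul (algebraMap (𝓞 F) F) (c : 𝓞 F) r).trans ?_
  rw [map_natCast, show algebraMap (𝓞 F) F r = m * v i from hr]
  push_cast
  ring

theorem mem_denominatorLattice {m : ℕ} {v : Fin 2 → F}
    (h : ∀ i, (m : 𝔸ᶠ[F]) * finiteCoords (diag v) i ∈ integralAdeles F) :
    v ∈ denominatorLattice F m := by
  intro i
  refine mem_integers_of_valuation_le_one F (m * v i) fun p => ?_
  rw [← p.valuedAdicCompletion_eq_valuation']
  have h1 := h i p
  have h2 : ((m : 𝔸ᶠ[F]) * finiteCoords (diag v) i) p = ((m * v i : F) : p.adicCompletion F) := by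
    have h3 : (m : 𝔸ᶠ[F]) * finiteCoords (diag v) i = finitePart (algebraMap F 𝔸[F] (m * v i)) := by
      rw [map_mul, map_mul, map_natCast, map_natCast]
      rfl
    rw [h3]; rfl
  rw [h2] at h1
  exact h1

variable [IsTotallyReal F]

theorem norm_realCoords_apply (x : Fin 2 → 𝔸[F]) (i : Fin 2) (w : InfinitePlace F) :
    ‖realCoords x i w‖ = ‖archEval w (x i)‖ :=
  (InfinitePlace.Completion.isometry_extensionEmbeddingOfIsReal _).norm_map_of_map_zero
    (map_zero _) _

/-- `F` being totally real, the norm of `realCoords x` is the largest archimedean absolute value of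
a coordinate of `x`. -/
theorem norm_archEval_le (x : Fin 2 → 𝔸[F]) (i : Fin 2) (w : InfinitePlace F) :
    ‖archEval w (x i)‖ ≤ ‖realCoords x‖ := by
  rw [← norm_realCoords_apply]
  exact (norm_le_pi_norm (realCoords x i) w).trans (norm_le_pi_norm (realCoords x) i)

theorem norm_realCoords_diag_pos {v : Fin 2 → F} (hv : v ≠ 0) : 0 < ‖realCoords (diag v)‖ := by
  obtain ⟨i, hi⟩ := Function.ne_iff.1 hv
  obtain ⟨w⟩ := (inferInstance : Nonempty (InfinitePlace F))
  refine lt_of_lt_of_le ?_ (norm_archEval_le (diag v) i w)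
  rw [diag, norm_archEval_algebraMap]
  exact InfinitePlace.pos_iff.2 hi

open mixedEmbedding in
/-- The multiples by `m` of the vectors of `denominatorLattice F m` lie in a lattice of rank
`2 [F : ℚ]` in a real vector space, whence the range of exponents. -/
theorem summable_indicator_denominatorLattice {m : ℕ} (hm : m ≠ 0) {α : ℝ}
    (hα : 2 * (Module.finrank ℚ F : ℝ) < α) :
    Summable fun v : {v : Fin 2 → F // v ≠ 0} =>
      (denominatorLattice F m).indicator (fun v => ‖realCoords (diag v)‖ ^ (-α)) v.1 := by
  classical
  let b : Module.Basis (Σ _ : Fin 2, _) ℝ (Fin 2 → mixedSpace F) := Pi.basis fun _ => latticeBasis F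
  let L : Submodule ℤ (Fin 2 → mixedSpace F) := Submodule.span ℤ (Set.range b)
  have hrank : Module.finrank ℤ L = 2 * Module.finrank ℚ F := by
    rw [ZLattice.rank ℝ L, Module.finrank_pi_fintype]
    simp only [mixedEmbedding.finrank, Finset.sum_const, Finset.card_univ, Fintype.card_fin,
      smul_eq_mul]
  have hsum : Summable fun z : L => ‖z‖ ^ (-α) := by
    refine ZLattice.summable_norm_rpow L (-α) ?_
    rw [hrank]
    push_cast
    linarith
  have hmem : ∀ v ∈ denominatorLattice F m, (fun i => mixedEmbedding F (m * v i)) ∈ L := by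
    intro v hv
    have h1 : (fun i => mixedEmbedding F (m * v i)) =
        ∑ i, Pi.single i (mixedEmbedding F (m * v i)) :=
      (Finset.univ_sum_single _).symm
    rw [h1]
    refine Submodule.sum_mem _ fun i _ => ?_
    obtain ⟨r, hr⟩ := hv i
    have h2 : mixedEmbedding F (m * v i) ∈ Submodule.span ℤ (Set.range (latticeBasis F)) := by
      rw [mem_span_latticeBasis]
      exact ⟨r, congrArg (mixedEmbedding F) hr⟩
    have h3 : Submodule.span ℤ (Set.range (latticeBasis F)) ≤
        L.comap (LinearMap.single ℤ (fun _ : Fin 2 => mixedSpace F) i) := by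
      rw [Submodule.span_le]
      rintro _ ⟨j, rfl⟩
      refine Submodule.subset_span ⟨⟨i, j⟩, ?_⟩
      exact Pi.basis_apply _ _
    exact h3 h2
  let s : Set {v : Fin 2 → F // v ≠ 0} := {v | v.1 ∈ denominatorLattice F m}
  have hm0 : (m : F) ≠ 0 := Nat.cast_ne_zero.2 hm
  let e : s → L := fun v => ⟨_, hmem v.1.1 v.2⟩
  have he : Function.Injective e := by
    intro v w h
    refine Subtype.ext (Subtype.ext (funext fun i => ?_))
    have h1 := congrFun (congrArg Subtype.val h) i
    exact mul_left_cancel₀ hm0 (mixedEmbedding_injective F h1)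
  have h1 := ((hsum.comp_injective he).mul_left ((m : ℝ) ^ α))
  have h2 : Summable fun v : s => ‖realCoords (diag v.1.1)‖ ^ (-α) := by
    refine Summable.of_nonneg_of_le (fun v => by positivity) (fun v => ?_) h1
    have hle : ‖e v‖ ≤ m * ‖realCoords (diag v.1.1)‖ := by
      refine (pi_norm_le_iff_of_nonneg (by positivity)).2 fun i => ?_
      rw [norm_eq_sup'_normAtPlace]
      refine Finset.sup'_le _ _ fun w _ => ?_
      change normAtPlace w (mixedEmbedding F (m * v.1.1 i)) ≤ _
      rw [normAtPlace_apply, map_mul]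
      have h3 := norm_archEval_le (diag v.1.1) i w
      rw [diag, norm_archEval_algebraMap] at h3
      have h4 : w (m : F) = m := by
        refine (w.norm_embedding_eq _).symm.trans ?_
        rw [map_natCast, Complex.norm_natCast]
      rw [h4]
      gcongr
    have hpos : 0 < ‖e v‖ := by
      rw [norm_pos_iff]
      intro h
      refine v.1.2 (funext fun i => ?_)
      have h5 := congrFun (congrArg Subtype.val h) i
      have h6 : m * v.1.1 i = 0 := mixedEmbedding_injective F (h5.trans (map_zero _).symm)
      exact (mul_eq_zero.1 h6).resolve_left hm0
    have hmpos : (0 : ℝ) < m := Nat.cast_pos.2 (Nat.pos_of_ne_zero hm)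
    have hα0 : 0 ≤ α := le_trans (by positivity) hα.le
    have hr := norm_realCoords_diag_pos v.1.2
    calc ‖realCoords (diag v.1.1)‖ ^ (-α)
        = (m : ℝ) ^ α * (m * ‖realCoords (diag v.1.1)‖) ^ (-α) := by
          rw [Real.mul_rpow hmpos.le hr.le, ← mul_assoc, ← Real.rpow_add hmpos]
          simp
      _ ≤ (m : ℝ) ^ α * ‖e v‖ ^ (-α) := by
          refine mul_le_mul_of_nonneg_left ?_ (by positivity)
          exact Real.rpow_le_rpow_of_nonpos hpos hle (by linarith)
  exact (summable_subtype_iff_indicator (s := s)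
    (f := fun v : {v : Fin 2 → F // v ≠ 0} => ‖realCoords (diag v.1)‖ ^ (-α))).1 h2
end Theta

/-! ### Decay of Schwartz-Bruhat functions at lattice points -/

section ThetaBound
variable {F : Type*} [Field F] [NumberField F] [IsTotallyReal F]

/-- Rapid decay of a Schwartz function, with real exponents. -/
theorem exists_rpow_norm_mul_le {E : Type*} [NormedAddCommGroup E] [NormedSpace ℝ E]
    (f : 𝓢(E, ℂ)) {α : ℝ} (hα : 0 ≤ α) : ∃ C : ℝ, 0 ≤ C ∧ ∀ x, ‖x‖ ^ α * ‖f x‖ ≤ C := by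
  obtain ⟨C₀, h₀, hC₀⟩ := f.decay 0 0
  obtain ⟨C₁, h₁, hC₁⟩ := f.decay ⌈α⌉₊ 0
  refine ⟨C₀ + C₁, by positivity, fun x => ?_⟩
  have h0 := hC₀ x
  have h1 := hC₁ x
  rw [norm_iteratedFDeriv_zero] at h0 h1
  have hx : ‖x‖ ^ α ≤ ‖x‖ ^ 0 + ‖x‖ ^ ⌈α⌉₊ := by
    rcases le_total ‖x‖ 1 with h | h
    · have := Real.rpow_le_one (norm_nonneg x) h hα
      have h3 : 0 ≤ ‖x‖ ^ ⌈α⌉₊ := by positivity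
      rw [pow_zero]
      linarith
    · have := Real.rpow_le_rpow_of_exponent_le h (Nat.le_ceil α)
      rw [Real.rpow_natCast] at this
      rw [pow_zero]
      linarith
  calc ‖x‖ ^ α * ‖f x‖ ≤ (‖x‖ ^ 0 + ‖x‖ ^ ⌈α⌉₊) * ‖f x‖ := by gcongr
    _ ≤ C₀ + C₁ := by rw [add_mul]; exact add_le_add h0 h1

omit [IsTotallyReal F] in
/-- `x = t⁻¹ g (g⁻¹ (t x))`, coordinatewise. -/
theorem eq_inv_mul_sum (g : GL (Fin 2) 𝔸[F]) (t : (𝔸[F])ˣ) (x : Fin 2 → 𝔸[F]) (i : Fin 2) :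
    x i = ((t⁻¹ : (𝔸[F])ˣ) : 𝔸[F]) * ∑ j, (g : Matrix (Fin 2) (Fin 2) 𝔸[F]) i j *
      (((g⁻¹ : GL (Fin 2) 𝔸[F]) : Matrix (Fin 2) (Fin 2) 𝔸[F]).mulVec ((t : 𝔸[F]) • x)) j := by
  have h : (g : Matrix (Fin 2) (Fin 2) 𝔸[F]).mulVec
      (((g⁻¹ : GL (Fin 2) 𝔸[F]) : Matrix (Fin 2) (Fin 2) 𝔸[F]).mulVec ((t : 𝔸[F]) • x)) =
      (t : 𝔸[F]) • x := by
    rw [Matrix.mulVec_mulVec, ← Units.val_mul, mul_inv_cancel, Units.val_one, Matrix.one_mulVec]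
  have h1 := congrFun h i
  change _ = ((t⁻¹ : (𝔸[F])ˣ) : 𝔸[F]) * (g : Matrix (Fin 2) (Fin 2) 𝔸[F]).mulVec _ i
  rw [h1, Pi.smul_apply, smul_eq_mul, ← mul_assoc, t.inv_mul, one_mul]

/-- The size of `g⁻¹ zⁿ t x` at the infinite places is at least a constant times `2ⁿ` that of `x`,
where `z` is the idele `archTwo F`, uniformly for `t` in a compact set. -/
theorem exists_norm_realCoords_le (g : GL (Fin 2) 𝔸[F]) {K : Set (𝔸[F])ˣ} (hK : IsCompact K) :
    ∃ A : ℝ, 0 ≤ A ∧ ∀ t ∈ K, ∀ (n : ℤ) (x : Fin 2 → 𝔸[F]),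
      2 ^ n * ‖realCoords x‖ ≤ A * ‖realCoords
        (((g⁻¹ : GL (Fin 2) 𝔸[F]) : Matrix (Fin 2) (Fin 2) 𝔸[F]).mulVec
          (((archTwo F ^ n * t : (𝔸[F])ˣ) : 𝔸[F]) • x))‖ := by
  have hb : ∀ w : InfinitePlace F, ∃ C : ℝ, ∀ t ∈ K, ‖archEval w ((t⁻¹ : (𝔸[F])ˣ) : 𝔸[F])‖ ≤ C := by
    intro w
    refine hK.exists_bound_of_continuousOn (f := fun t : (𝔸[F])ˣ =>
      archEval w ((t⁻¹ : (𝔸[F])ˣ) : 𝔸[F])) ?_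
    exact ((continuous_archEval w).comp (Units.continuous_val.comp continuous_inv)).continuousOn
  choose B hB using hb
  let G : ℝ := ∑ i, ∑ j, ∑ w, ‖archEval w ((g : Matrix (Fin 2) (Fin 2) 𝔸[F]) i j)‖
  let B' : ℝ := ∑ w, |B w|
  refine ⟨B' * (2 * G), by positivity, fun t ht n x => ?_⟩
  set z := ((g⁻¹ : GL (Fin 2) 𝔸[F]) : Matrix (Fin 2) (Fin 2) 𝔸[F]).mulVec
    (((archTwo F ^ n * t : (𝔸[F])ˣ) : 𝔸[F]) • x) with hz
  have h2 : (0 : ℝ) < 2 ^ n := by positivity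
  rw [← le_div_iff₀' h2]
  refine (pi_norm_le_iff_of_nonneg (by positivity)).2 fun i =>
    (pi_norm_le_iff_of_nonneg (by positivity)).2 fun w => ?_
  rw [norm_realCoords_apply, eq_inv_mul_sum g (archTwo F ^ n * t) x i, ← hz, map_mul, norm_mul,
    mul_inv, ← zpow_neg, Units.val_mul, map_mul, norm_mul, norm_archEval_archTwo_zpow, zpow_neg,
    le_div_iff₀' h2, ← mul_assoc, ← mul_assoc, mul_inv_cancel₀ h2.ne', one_mul]
  have h3 : ‖archEval w ((t⁻¹ : (𝔸[F])ˣ) : 𝔸[F])‖ ≤ B' :=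
    ((hB w t ht).trans (le_abs_self _)).trans
      (Finset.single_le_sum (f := fun w => |B w|) (fun _ _ => abs_nonneg _) (Finset.mem_univ w))
  have h4 : ∀ j, ‖archEval w ((g : Matrix (Fin 2) (Fin 2) 𝔸[F]) i j)‖ ≤ G := by
    intro j
    refine (Finset.single_le_sum
      (f := fun w => ‖archEval w ((g : Matrix (Fin 2) (Fin 2) 𝔸[F]) i j)‖)
      (fun _ _ => norm_nonneg _) (Finset.mem_univ w)).trans ?_
    refine (Finset.single_le_sum
      (f := fun j => ∑ w, ‖archEval w ((g : Matrix (Fin 2) (Fin 2) 𝔸[F]) i j)‖)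
      (fun _ _ => by positivity) (Finset.mem_univ j)).trans ?_
    exact (Finset.single_le_sum
      (f := fun i => ∑ j, ∑ w, ‖archEval w ((g : Matrix (Fin 2) (Fin 2) 𝔸[F]) i j)‖)
      (fun _ _ => by positivity) (Finset.mem_univ i))
  rw [mul_assoc B']
  refine mul_le_mul h3 ?_ (norm_nonneg _) (by positivity)
  rw [map_sum]
  refine (norm_sum_le _ _).trans ?_
  have h5 : ∀ j ∈ Finset.univ, ‖archEval w ((g : Matrix (Fin 2) (Fin 2) 𝔸[F]) i j * z j)‖ ≤
      G * ‖realCoords z‖ := by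
    intro j _
    rw [map_mul, norm_mul]
    exact mul_le_mul (h4 j) (norm_archEval_le z j w) (norm_nonneg _) (by positivity)
  refine (Finset.sum_le_card_nsmul _ _ _ h5).trans_eq ?_
  rw [Finset.card_univ, Fintype.card_fin, nsmul_eq_mul]
  push_cast
  ring

omit [IsTotallyReal F] in
/-- If the finite part of `g⁻¹ zⁿ t v` stays in a compact set, then so does that of `v`, and the
denominators of `v` are bounded; the finite part of `zⁿ` is `1`. -/
theorem exists_mem_denominatorLattice (g : GL (Fin 2) 𝔸[F]) {K : Set (𝔸[F])ˣ} (hK : IsCompact K)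
    {S : Set (Fin 2 → 𝔸ᶠ[F])} (hS : IsCompact S) :
    ∃ m : ℕ, m ≠ 0 ∧ ∀ t ∈ K, ∀ (n : ℤ) (v : Fin 2 → F),
      finiteCoords (((g⁻¹ : GL (Fin 2) 𝔸[F]) : Matrix (Fin 2) (Fin 2) 𝔸[F]).mulVec
          (((archTwo F ^ n * t : (𝔸[F])ˣ) : 𝔸[F]) • diag v)) ∈ S → v ∈ denominatorLattice F m := by
  let f : Fin 2 → (𝔸[F])ˣ × (Fin 2 → 𝔸ᶠ[F]) → 𝔸ᶠ[F] := fun i p =>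
    finitePart ((p.1⁻¹ : (𝔸[F])ˣ) : 𝔸[F]) *
      ∑ j, finitePart ((g : Matrix (Fin 2) (Fin 2) 𝔸[F]) i j) * p.2 j
  have hf : ∀ i, Continuous (f i) := by
    intro i
    refine Continuous.mul (continuous_finitePart.comp
      (Units.continuous_val.comp (continuous_inv.comp continuous_fst))) ?_
    exact continuous_finsetSum _ fun j _ => continuous_const.mul
      ((continuous_apply j).comp continuous_snd)
  obtain ⟨m, hm0, hm⟩ := exists_denominator_of_isCompact
    (isCompact_iUnion fun i => (hK.prod hS).image (hf i))
  refine ⟨m, hm0, fun t ht n v hv => mem_denominatorLattice fun i => ?_⟩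
  refine hm _ (Set.mem_iUnion.2 ⟨i, (t, _), ⟨ht, hv⟩, ?_⟩)
  have h := congrArg finitePart (eq_inv_mul_sum g (archTwo F ^ n * t) (diag v) i)
  rw [map_mul, mul_inv, ← zpow_neg, Units.val_mul, map_mul, finitePart_archTwo_zpow, one_mul,
    map_sum] at h
  simp only [map_mul] at h
  exact h.symm

/-- The decay of `gφ` at the dilates of the vectors of `F²`. The lattice does not depend on the
exponent `α`. -/
theorem norm_act_le_of_mem_schwartzBruhat {φ : (Fin 2 → 𝔸[F]) → ℂ} (hφ : φ ∈ schwartzBruhat F)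
    (g : GL (Fin 2) 𝔸[F]) {K : Set (𝔸[F])ˣ} (hK : IsCompact K) :
    ∃ m : ℕ, m ≠ 0 ∧ ∀ α : ℝ, 0 ≤ α → ∃ C : ℝ, 0 ≤ C ∧ ∀ t ∈ K, ∀ (n : ℤ) (v : Fin 2 → F), v ≠ 0 →
      ‖act g φ (((archTwo F ^ n * t : (𝔸[F])ˣ) : 𝔸[F]) • diag v)‖ ≤
        C * ((2 : ℝ) ^ n) ^ (-α) *
          (denominatorLattice F m).indicator (fun v => ‖realCoords (diag v)‖ ^ (-α)) v := by
  induction hφ using Submodule.span_induction with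
  | mem φ h =>
    obtain ⟨φf, φi, hφf, hφfc, rfl⟩ := h
    obtain ⟨A, hA0, hA⟩ := exists_norm_realCoords_le g hK
    obtain ⟨m, hm0, hm⟩ := exists_mem_denominatorLattice g hK hφfc
    obtain ⟨Cf, hCf⟩ := hφf.continuous.bounded_above_of_compact_support hφfc
    refine ⟨m, hm0, fun α hα => ?_⟩
    obtain ⟨Ci, hCi0, hCi⟩ := exists_rpow_norm_mul_le φi hα
    have hCf0 : 0 ≤ Cf := (norm_nonneg _).trans (hCf 0)
    refine ⟨Cf * (A ^ α * Ci), by positivity, fun t ht n v hv => ?_⟩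
    have hr := norm_realCoords_diag_pos hv
    have h2 : (0 : ℝ) < 2 ^ n := by positivity
    unfold act
    set z := ((g⁻¹ : GL (Fin 2) 𝔸[F]) : Matrix (Fin 2) (Fin 2) 𝔸[F]).mulVec
      (((archTwo F ^ n * t : (𝔸[F])ˣ) : 𝔸[F]) • diag v) with hz
    by_cases hvm : v ∈ denominatorLattice F m
    · rw [Set.indicator_of_mem hvm, norm_mul, mul_assoc, mul_assoc Cf]
      refine mul_le_mul (hCf _) ?_ (norm_nonneg _) hCf0
      rw [← Real.mul_rpow h2.le hr.le, Real.rpow_neg (by positivity), ← div_eq_mul_inv,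
        le_div_iff₀ (by positivity)]
      calc ‖φi (realCoords z)‖ * (2 ^ n * ‖realCoords (diag v)‖) ^ α
          ≤ ‖φi (realCoords z)‖ * (A * ‖realCoords z‖) ^ α := by
            refine mul_le_mul_of_nonneg_left ?_ (norm_nonneg _)
            exact Real.rpow_le_rpow (by positivity) (hA t ht n (diag v)) hα
        _ = A ^ α * (‖realCoords z‖ ^ α * ‖φi (realCoords z)‖) := by
            rw [Real.mul_rpow hA0 (norm_nonneg _)]; ring
        _ ≤ _ := by gcongr; exact hCi _
    · have h0 : φf (finiteCoords z) = 0 := by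
        by_contra h
        exact hvm (hm t ht n v (subset_tsupport _ h))
      simp only [Set.indicator_of_notMem hvm, h0, zero_mul, norm_zero, mul_zero, le_refl]
  | zero => exact ⟨1, one_ne_zero, fun α _ => ⟨0, le_rfl, fun t _ n v _ => by simp [act]⟩⟩
  | add φ₁ φ₂ _ _ h₁ h₂ =>
    obtain ⟨m₁, hm₁, h₁⟩ := h₁
    obtain ⟨m₂, hm₂, h₂⟩ := h₂
    refine ⟨m₁ * m₂, mul_ne_zero hm₁ hm₂, fun α hα => ?_⟩
    obtain ⟨C₁, hC₁, h₁⟩ := h₁ α hα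
    obtain ⟨C₂, hC₂, h₂⟩ := h₂ α hα
    refine ⟨C₁ + C₂, by positivity, fun t ht n v hv => ?_⟩
    have hle : ∀ m, m ∣ m₁ * m₂ →
        (denominatorLattice F m).indicator (fun v => ‖realCoords (diag v)‖ ^ (-α)) v ≤
        (denominatorLattice F (m₁ * m₂)).indicator (fun v => ‖realCoords (diag v)‖ ^ (-α)) v :=
      fun m hm => Set.indicator_le_indicator_of_subset (denominatorLattice_mono hm)
        (fun _ => by positivity) v
    have e₁ := (h₁ t ht n v hv).trans (mul_le_mul_of_nonneg_left (hle m₁ (Dvd.intro _ rfl))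
      (by positivity))
    have e₂ := (h₂ t ht n v hv).trans (mul_le_mul_of_nonneg_left (hle m₂ (Dvd.intro_left _ rfl))
      (by positivity))
    refine (norm_add_le _ _).trans ((add_le_add e₁ e₂).trans_eq ?_)
    ring
  | smul c φ _ h =>
    obtain ⟨m, hm, h⟩ := h
    refine ⟨m, hm, fun α hα => ?_⟩
    obtain ⟨C, hC, h⟩ := h α hα
    refine ⟨‖c‖ * C, by positivity, fun t ht n v hv => ?_⟩
    refine (norm_mul_le _ _).trans ?_
    rw [mul_assoc, mul_assoc, ← mul_assoc C]
    exact mul_le_mul_of_nonneg_left (h t ht n v hv) (norm_nonneg _)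

end ThetaBound

/-! ### Continuity of the idele norm and of Schwartz-Bruhat functions -/

section IdeleNorm
variable {F : Type*} [Field F] [NumberField F]

theorem ideleNorm_apply (t : (𝔸[F])ˣ) : ideleNorm t =
    (∏ w : InfinitePlace F, ‖archEval w (t : 𝔸[F])‖ ^ w.mult) *
      ∏ᶠ v : HeightOneSpectrum (𝓞 F), ‖(finitePart (t : 𝔸[F])) v‖ := rfl

theorem ideleNorm_pos (t : (𝔸[F])ˣ) : 0 < ideleNorm t := by
  refine lt_of_le_of_ne ?_ (Ne.symm ?_)
  · rw [ideleNorm_apply]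
    exact mul_nonneg (Finset.prod_nonneg fun w _ => by positivity)
      (finprod_nonneg fun v => norm_nonneg _)
  · intro h
    have h1 : ideleNorm (t * t⁻¹) = 1 := by rw [mul_inv_cancel, map_one]
    rw [map_mul, h, zero_mul] at h1
    exact zero_ne_one h1

theorem ideleNorm_archTwo_zpow (n : ℤ) :
    ideleNorm (archTwo F ^ n) = ((2 : ℝ) ^ n) ^ Module.finrank ℚ F := by
  rw [ideleNorm_apply, finitePart_archTwo_zpow]
  simp only [norm_archEval_archTwo_zpow]
  rw [Finset.prod_pow_eq_pow_sum, InfinitePlace.sum_mult_eq]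
  have : ∀ v : HeightOneSpectrum (𝓞 F), ‖(1 : 𝔸ᶠ[F]) v‖ = 1 := fun v =>
    norm_one (α := v.adicCompletion F)
  simp only [this, finprod_one, mul_one]

theorem continuous_ideleNorm : Continuous (ideleNorm : (𝔸[F])ˣ → ℝ) := by
  change Continuous fun t : (𝔸[F])ˣ => (∏ w : InfinitePlace F, ‖archEval w (t : 𝔸[F])‖ ^ w.mult) *
      ∏ᶠ v : HeightOneSpectrum (𝓞 F), ‖(finitePart (t : 𝔸[F])) v‖
  refine Continuous.mul (continuous_finsetProd _ fun w _ =>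
    (((continuous_archEval w).comp Units.continuous_val).norm).pow _) ?_
  refine continuous_iff_continuousAt.2 fun t₀ => ?_
  -- the finite part of the norm is constant on the cosets of `∏ᵥ 𝓞ᵥˣ`
  have hU : IsOpen {t : (𝔸[F])ˣ | finitePart ((t₀⁻¹ * t : (𝔸[F])ˣ) : 𝔸[F]) ∈ integralAdeles F ∧
      finitePart ((t⁻¹ * t₀ : (𝔸[F])ˣ) : 𝔸[F]) ∈ integralAdeles F} := by
    refine IsOpen.inter ?_ ?_
    · exact isOpen_integralAdeles.preimage (continuous_finitePart.comp
        (Units.continuous_val.comp (continuous_const.mul continuous_id)))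
    · exact isOpen_integralAdeles.preimage (continuous_finitePart.comp
        (Units.continuous_val.comp (continuous_inv.mul continuous_const)))
  have hle : ∀ (t u : (𝔸[F])ˣ), finitePart ((t⁻¹ * u : (𝔸[F])ˣ) : 𝔸[F]) ∈ integralAdeles F →
      ∀ v, ‖(finitePart (u : 𝔸[F])) v‖ ≤ ‖(finitePart (t : 𝔸[F])) v‖ := by
    intro t u h v
    have h1 : (finitePart (u : 𝔸[F])) v =
        (finitePart (t : 𝔸[F])) v * (finitePart ((t⁻¹ * u : (𝔸[F])ˣ) : 𝔸[F])) v :=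
      congrArg (fun x : (𝔸[F])ˣ => (finitePart (x : 𝔸[F])) v) (mul_inv_cancel_left t u).symm
    rw [h1, norm_mul]
    refine mul_le_of_le_one_right (norm_nonneg _) ?_
    exact Valued.toNormedField.norm_le_one_iff.2 (h v)
  refine (continuousAt_const (y := ∏ᶠ v : HeightOneSpectrum (𝓞 F),
    ‖(finitePart (t₀ : 𝔸[F])) v‖)).congr ?_
  filter_upwards [hU.mem_nhds ⟨by
    rw [inv_mul_cancel]; exact fun v => (v.adicCompletionIntegers F).one_mem, by
    rw [inv_mul_cancel]; exact fun v => (v.adicCompletionIntegers F).one_mem⟩] with t ht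
  exact finprod_congr fun v => le_antisymm (hle _ _ ht.2 v) (hle _ _ ht.1 v)

theorem continuous_ideleNorm_cpow (s : ℂ) :
    Continuous fun t : (𝔸[F])ˣ => (ideleNorm t : ℂ) ^ s := by
  refine continuous_iff_continuousAt.2 fun t => ?_
  refine ContinuousAt.cpow ?_ continuousAt_const (Or.inl ?_)
  · exact (Complex.continuous_ofReal.comp continuous_ideleNorm).continuousAt
  · exact ideleNorm_pos t

theorem UnitaryHeckeCharacter.continuous_eval (ω : UnitaryHeckeCharacter F) :
    Continuous ω.eval :=
  continuous_subtype_val.comp ω.toContinuousMonoidHom.continuous_toFun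

theorem UnitaryHeckeCharacter.norm_eval (ω : UnitaryHeckeCharacter F) (t : (𝔸[F])ˣ) :
    ‖ω.eval t‖ = 1 := Circle.norm_coe _

theorem norm_ideleNorm_cpow (s : ℂ) (t : (𝔸[F])ˣ) :
    ‖(ideleNorm t : ℂ) ^ s‖ = ideleNorm t ^ s.re :=
  Complex.norm_cpow_eq_rpow_re_of_pos (ideleNorm_pos t) s

end IdeleNorm

section Continuity
variable {F : Type*} [Field F] [NumberField F] [IsTotallyReal F]

theorem continuous_realCoords : Continuous (realCoords : (Fin 2 → 𝔸[F]) → _) :=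
  continuous_pi fun i => continuous_pi fun w =>
    (InfinitePlace.Completion.isometry_extensionEmbeddingOfIsReal _).continuous.comp
      ((continuous_archEval w).comp (continuous_apply i))

omit [IsTotallyReal F] in
theorem continuous_finiteCoords : Continuous (finiteCoords : (Fin 2 → 𝔸[F]) → _) :=
  continuous_pi fun i => continuous_finitePart.comp (continuous_apply i)

theorem continuous_of_mem_schwartzBruhat {φ : (Fin 2 → 𝔸[F]) → ℂ} (hφ : φ ∈ schwartzBruhat F) :
    Continuous φ := by
  induction hφ using Submodule.span_induction with
  | mem φ h =>
    obtain ⟨φf, φi, hφf, -, rfl⟩ := h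
    exact (hφf.continuous.comp continuous_finiteCoords).mul
      (φi.continuous.comp continuous_realCoords)
  | zero => exact continuous_const
  | add φ₁ φ₂ _ _ h₁ h₂ => exact h₁.add h₂
  | smul c φ _ h => exact h.const_smul c

theorem continuous_act {φ : (Fin 2 → 𝔸[F]) → ℂ} (hφ : φ ∈ schwartzBruhat F)
    (g : GL (Fin 2) 𝔸[F]) : Continuous (act g φ) :=
  (continuous_of_mem_schwartzBruhat hφ).comp (continuous_const.matrix_mulVec continuous_id)

end Continuity

/-! ### The theta series as a sum of functions on the ideles -/

section Summand
variable {F : Type*} [Field F] [NumberField F]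

/-- The contribution `ω(t) |t|^{2s} (gφ)(tv)` of a vector `v` to the integrand of the Eisenstein
series. -/
noncomputable def thetaSummand (ω : UnitaryHeckeCharacter F) (s : ℂ) (φ : (Fin 2 → 𝔸[F]) → ℂ)
    (g : GL (Fin 2) 𝔸[F]) (v : Fin 2 → F) (t : (𝔸[F])ˣ) : ℂ :=
  ω.eval t * (ideleNorm t : ℂ) ^ (2 * s) * act g φ ((t : 𝔸[F]) • diag v)

variable (ω : UnitaryHeckeCharacter F) (s : ℂ) (φ : (Fin 2 → 𝔸[F]) → ℂ) (g : GL (Fin 2) 𝔸[F])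

theorem thetaTerm_mul_scalar_inv (t : (𝔸[F])ˣ) (v : {v : Fin 2 → F // v ≠ 0}) :
    thetaTerm φ (g * (Matrix.GeneralLinearGroup.scalar (Fin 2) t)⁻¹) v =
      act g φ ((t : 𝔸[F]) • diag v.1) :=
  act_mul_scalar_inv g t φ _

theorem eisensteinIntegrand_eq_tsum (t : (𝔸[F])ˣ) : eisensteinIntegrand ω s φ g t =
    ∑' v : {v : Fin 2 → F // v ≠ 0}, thetaSummand ω s φ g v.1 t := by
  unfold eisensteinIntegrand theta thetaSummand
  rw [tsum_mul_left]
  simp only [thetaTerm_mul_scalar_inv]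

theorem thetaSummand_principalIdele_mul (a : Fˣ) (v : Fin 2 → F) (t : (𝔸[F])ˣ) :
    thetaSummand ω s φ g v (principalIdele F a * t) = thetaSummand ω s φ g (a • v) t := by
  unfold thetaSummand
  rw [ω.eval_principalIdele_mul, map_mul, ideleNorm_principalIdele, one_mul]
  congr 2
  ext1 i
  change algebraMap F 𝔸[F] a * (t : 𝔸[F]) * algebraMap F 𝔸[F] (v i) =
    (t : 𝔸[F]) * algebraMap F 𝔸[F] ((a : F) * v i)
  rw [map_mul]
  ring

theorem act_toAdelic_mul (γ : GL (Fin 2) F) (v : Fin 2 → F) (t : (𝔸[F])ˣ) :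
    act (toAdelic F γ * g) φ ((t : 𝔸[F]) • diag v) = act g φ ((t : 𝔸[F]) •
      diag (((γ⁻¹ : GL (Fin 2) F) : Matrix (Fin 2) (Fin 2) F).mulVec v)) := by
  unfold act
  rw [mul_inv_rev, Units.val_mul, ← Matrix.mulVec_mulVec, ← map_inv, Matrix.mulVec_smul]
  congr 3
  exact ((algebraMap F 𝔸[F]).map_mulVec _ _ ·|>.symm) |> funext

theorem zetaIntegrand_principalIdele_mul (a : Fˣ) (t : (𝔸[F])ˣ) :
    zetaIntegrand ω s φ g (principalIdele F a * t) = thetaSummand ω s φ g ![(a : F), 0] t := by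
  unfold zetaIntegrand thetaSummand
  rw [ω.eval_principalIdele_mul, map_mul, ideleNorm_principalIdele, one_mul, mul_comm (ω.eval t)]
  congr 2
  ext1 i
  fin_cases i
  · change algebraMap F 𝔸[F] a * (t : 𝔸[F]) = (t : 𝔸[F]) * algebraMap F 𝔸[F] a
    ring
  · change (0 : 𝔸[F]) = (t : 𝔸[F]) * algebraMap F 𝔸[F] 0
    rw [map_zero, mul_zero]

theorem zetaIntegrand_toAdelic_mul (γ : GL (Fin 2) F) (a : Fˣ) (t : (𝔸[F])ˣ) :
    zetaIntegrand ω s φ (toAdelic F γ * g) (principalIdele F a * t) = thetaSummand ω s φ g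
      (((γ⁻¹ : GL (Fin 2) F) : Matrix (Fin 2) (Fin 2) F).mulVec ![(a : F), 0]) t := by
  rw [zetaIntegrand_principalIdele_mul]
  unfold thetaSummand
  rw [act_toAdelic_mul]

variable [IsTotallyReal F]

theorem continuous_thetaSummand {φ : (Fin 2 → 𝔸[F]) → ℂ} (hφ : φ ∈ schwartzBruhat F)
    (v : Fin 2 → F) : Continuous (thetaSummand ω s φ g v) := by
  refine (ω.continuous_eval.mul (continuous_ideleNorm_cpow _)).mul ((continuous_act hφ g).comp ?_)
  exact Units.continuous_val.smul continuous_const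

theorem continuous_zetaIntegrand {φ : (Fin 2 → 𝔸[F]) → ℂ} (hφ : φ ∈ schwartzBruhat F) :
    Continuous (zetaIntegrand ω s φ g) := by
  refine ((continuous_ideleNorm_cpow _).mul ω.continuous_eval).mul ((continuous_act hφ g).comp ?_)
  refine continuous_pi fun i => ?_
  fin_cases i
  · exact Units.continuous_val
  · exact continuous_const

/-- The theta series converges absolutely. -/
theorem summable_thetaTerm {φ : (Fin 2 → 𝔸[F]) → ℂ} (hφ : φ ∈ schwartzBruhat F) :
    Summable (thetaTerm φ g) := by
  obtain ⟨m, hm, h⟩ := norm_act_le_of_mem_schwartzBruhat hφ g (isCompact_singleton (x := 1))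
  obtain ⟨C, hC, h⟩ := h (2 * (Module.finrank ℚ F : ℝ) + 1) (by positivity)
  refine Summable.of_norm_bounded
    ((summable_indicator_denominatorLattice hm (lt_add_one _)).mul_left C) fun v => ?_
  have h1 := h 1 rfl 0 v.1 v.2
  rw [zpow_zero, mul_one, zpow_zero, Real.one_rpow, mul_one, Units.val_one, one_smul] at h1
  exact h1

/-- For each exponent `α > 2 [F : ℚ]`, a bound for the theta series at the dilates of a compact set
of ideles. -/
theorem tsum_enorm_thetaSummand_le {φ : (Fin 2 → 𝔸[F]) → ℂ} (hφ : φ ∈ schwartzBruhat F)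
    (hs : 0 ≤ s.re) {K : Set (𝔸[F])ˣ} (hK : IsCompact K) {α : ℝ}
    (hα : 2 * (Module.finrank ℚ F : ℝ) < α) :
    ∃ C : ℝ, 0 ≤ C ∧ ∀ t ∈ K, ∀ n : ℤ,
      ∑' v : {v : Fin 2 → F // v ≠ 0}, ‖thetaSummand ω s φ g v.1 (archTwo F ^ n * t)‖ₑ ≤
        ENNReal.ofReal (C * ((2 : ℝ) ^ n) ^ (2 * Module.finrank ℚ F * s.re - α)) := by
  obtain ⟨m, hm, h⟩ := norm_act_le_of_mem_schwartzBruhat hφ g hK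
  have hα0 : 0 ≤ α := le_trans (by positivity) hα.le
  obtain ⟨C, hC, h⟩ := h α hα0
  obtain ⟨B, hB⟩ := hK.exists_bound_of_continuousOn continuous_ideleNorm.continuousOn
  have hsum := summable_indicator_denominatorLattice (F := F) hm hα
  set f : {v : Fin 2 → F // v ≠ 0} → ℝ := fun v =>
    (denominatorLattice F m).indicator (fun v => ‖realCoords (diag v)‖ ^ (-α)) v.1 with hf
  have hf0 : ∀ v, 0 ≤ f v := fun v => Set.indicator_nonneg (fun _ _ => by positivity) _
  refine ⟨|B| ^ (2 * s.re) * C * ∑' v, f v, by have : 0 ≤ ∑' v, f v := tsum_nonneg hf0; positivity,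
    fun t ht n => ?_⟩
  have h2 : (0 : ℝ) < 2 ^ n := by positivity
  set X : ℝ := |B| ^ (2 * s.re) * C * ((2 : ℝ) ^ n) ^ (2 * Module.finrank ℚ F * s.re - α) with hX
  have hterm : ∀ v : {v : Fin 2 → F // v ≠ 0},
      ‖thetaSummand ω s φ g v.1 (archTwo F ^ n * t)‖ₑ ≤ ENNReal.ofReal (X * f v) := by
    intro v
    rw [← ofReal_norm]
    refine ENNReal.ofReal_le_ofReal ?_
    have hN : ideleNorm (archTwo F ^ n * t) ≤ ((2 : ℝ) ^ n) ^ (Module.finrank ℚ F : ℝ) * |B| := by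
      rw [map_mul, ideleNorm_archTwo_zpow, Real.rpow_natCast]
      refine mul_le_mul_of_nonneg_left ?_ (by positivity)
      exact (le_abs_self _).trans ((hB t ht).trans (le_abs_self _))
    have hre : (2 * s).re = 2 * s.re := by simp
    rw [thetaSummand, norm_mul, norm_mul, ω.norm_eval, one_mul, norm_ideleNorm_cpow, hre]
    calc ideleNorm (archTwo F ^ n * t) ^ (2 * s.re) *
          ‖act g φ (((archTwo F ^ n * t : (𝔸[F])ˣ) : 𝔸[F]) • diag v.1)‖
        ≤ (((2 : ℝ) ^ n) ^ (Module.finrank ℚ F : ℝ) * |B|) ^ (2 * s.re) *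
            (C * ((2 : ℝ) ^ n) ^ (-α) * f v) := by
          refine mul_le_mul ?_ (h t ht n v.1 v.2) (norm_nonneg _) (by positivity)
          exact Real.rpow_le_rpow (ideleNorm_pos _).le hN (by positivity)
      _ = X * f v := by
          rw [Real.mul_rpow (by positivity) (abs_nonneg _), ← Real.rpow_mul h2.le, hX,
            sub_eq_add_neg, Real.rpow_add h2]
          ring_nf
  refine (ENNReal.tsum_le_tsum hterm).trans_eq ?_
  have hX0 : 0 ≤ X := by positivity
  rw [← ENNReal.ofReal_tsum_of_nonneg (fun v => mul_nonneg hX0 (hf0 v)) (hsum.mul_left X),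
    tsum_mul_left, hX]
  congr 1
  ring

theorem summable_pow_natAbs {q : ℝ} (h0 : 0 ≤ q) (h1 : q < 1) :
    Summable fun n : ℤ => q ^ n.natAbs := by
  refine Summable.of_nat_of_neg ?_ ?_ <;>
  simpa using summable_geometric_of_lt_one h0 h1

/-- The bounds for the theta series at the dilates of a compact set of ideles are summable when
`Re s > 1`. -/
theorem exists_tsum_enorm_thetaSummand_le {φ : (Fin 2 → 𝔸[F]) → ℂ} (hφ : φ ∈ schwartzBruhat F)
    (hs : 1 < s.re) {K : Set (𝔸[F])ˣ} (hK : IsCompact K) :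
    ∃ b : ℤ → ℝ, Summable b ∧ ∀ t ∈ K, ∀ n : ℤ,
      ∑' v : {v : Fin 2 → F // v ≠ 0}, ‖thetaSummand ω s φ g v.1 (archTwo F ^ n * t)‖ₑ ≤
        ENNReal.ofReal (b n) := by
  set d : ℝ := ((Module.finrank ℚ F : ℕ) : ℝ) with hd
  have hd0 : 0 < d := Nat.cast_pos.2 Module.finrank_pos
  have hs0 : 0 ≤ s.re := by linarith
  have hds : 0 < d * (s.re - 1) := mul_pos hd0 (by linarith)
  -- rapid decay at the large dilates, and an exponent slightly above `2d` at the small ones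
  obtain ⟨C₁, hC₁, h₁⟩ := tsum_enorm_thetaSummand_le ω s g hφ hs0 hK (α := 2 * d * s.re + 1)
    (by nlinarith)
  obtain ⟨C₂, hC₂, h₂⟩ := tsum_enorm_thetaSummand_le ω s g hφ hs0 hK (α := d * (s.re + 1))
    (by nlinarith)
  set q : ℝ := 2 ^ (-(d * (s.re - 1))) with hq
  have hq0 : 0 ≤ q := by positivity
  have hq1 : q < 1 := Real.rpow_lt_one_of_one_lt_of_neg one_lt_two (by linarith)
  refine ⟨fun n => C₁ * (1 / 2) ^ n.natAbs + C₂ * q ^ n.natAbs,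
    ((summable_pow_natAbs (by norm_num) (by norm_num)).mul_left C₁).add
      ((summable_pow_natAbs hq0 hq1).mul_left C₂), fun t ht n => ?_⟩
  rcases le_total 0 n with hn | hn
  · refine (h₁ t ht n).trans (ENNReal.ofReal_le_ofReal ?_)
    obtain ⟨k, rfl⟩ := Int.eq_ofNat_of_zero_le hn
    have e : ((2 : ℝ) ^ (k : ℤ)) ^ (2 * d * s.re - (2 * d * s.re + 1)) = (1 / 2) ^ k := by
      rw [show 2 * d * s.re - (2 * d * s.re + 1) = -1 by ring, Real.rpow_neg_one, zpow_natCast,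
        one_div, inv_pow]
    rw [e]
    beta_reduce
    rw [Int.natAbs_natCast]
    have : 0 ≤ C₂ * q ^ k := by positivity
    linarith
  · refine (h₂ t ht n).trans (ENNReal.ofReal_le_ofReal ?_)
    obtain ⟨k, rfl⟩ := Int.exists_eq_neg_ofNat hn
    have e : ((2 : ℝ) ^ (-(k : ℤ))) ^ (2 * d * s.re - d * (s.re + 1)) = q ^ k := by
      rw [show 2 * d * s.re - d * (s.re + 1) = d * (s.re - 1) by ring, hq, ← Real.rpow_natCast,
        ← Real.rpow_mul two_pos.le, ← Real.rpow_intCast, ← Real.rpow_mul two_pos.le]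
      congr 1
      push_cast
      ring
    rw [e]
    beta_reduce
    rw [Int.natAbs_neg, Int.natAbs_natCast]
    have : 0 ≤ C₁ * (1 / 2) ^ k := by positivity
    linarith

end Summand

/-! ### Integration over the idele class group -/

section FundamentalDomainIntegral
open scoped Pointwise ENNReal

/-- The integral of a nonnegative invariant function over a fundamental domain is at most the sum
of its integrals over sets whose translates cover the space. -/
theorem setLIntegral_le_tsum_of_isFundamentalDomain {Γ X ι : Type*} [Group Γ] [Countable Γ]
    [Countable ι] [MulAction Γ X] [MeasurableSpace X] [MeasurableConstSMul Γ X] {μ : Measure X}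
    [SMulInvariantMeasure Γ X μ] {D : Set X} (hD : IsFundamentalDomain Γ D μ) (M : ι → Set X)
    (hM : ∀ x, ∃ γ : Γ, ∃ i, γ • x ∈ M i) {h : X → ℝ≥0∞} (hinv : ∀ (γ : Γ) x, h (γ • x) = h x) :
    ∫⁻ x in D, h x ∂μ ≤ ∑' i, ∫⁻ x in M i, h x ∂μ := by
  have hcover : D ⊆ ⋃ i, ⋃ γ : Γ, γ • M i ∩ D := by
    intro x hx
    obtain ⟨γ, i, hi⟩ := hM x
    exact Set.mem_iUnion₂.2 ⟨i, γ⁻¹, by rwa [Set.mem_inv_smul_set_iff], hx⟩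
  calc ∫⁻ x in D, h x ∂μ ≤ ∫⁻ x in ⋃ i, ⋃ γ : Γ, γ • M i ∩ D, h x ∂μ := lintegral_mono_set hcover
    _ ≤ ∑' i, ∫⁻ x in ⋃ γ : Γ, γ • M i ∩ D, h x ∂μ := lintegral_iUnion_le _ _
    _ ≤ ∑' i, ∑' γ : Γ, ∫⁻ x in γ • M i ∩ D, h x ∂μ :=
      ENNReal.tsum_le_tsum fun i => lintegral_iUnion_le _ _
    _ = ∑' i, ∫⁻ x in M i, h x ∂μ := by
      refine tsum_congr fun i => ?_
      rw [hD.setLIntegral_eq_tsum']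
      simp only [hinv]

end FundamentalDomainIntegral

section Convergence
variable {F : Type*} [Field F]

theorem vecCons_unit_ne_zero (a : Fˣ) : ![(a : F), 0] ≠ 0 := fun h =>
  a.ne_zero (congrFun h 0)

variable [NumberField F]

/-- The identification of `Fˣ` with the group `(principalIdeles F).op`, which acts on the ideles by
right multiplication. -/
noncomputable def principalIdeleOp (F : Type*) [Field F] [NumberField F] :
    Fˣ ≃ (principalIdeles F).op :=
  (MonoidHom.ofInjective (principalIdele_injective)).toEquiv.trans (principalIdeles F).equivOp

theorem principalIdeleOp_smul (a : Fˣ) (t : (𝔸[F])ˣ) :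
    principalIdeleOp F a • t = principalIdele F a * t :=
  mul_comm t _

variable (ω : UnitaryHeckeCharacter F) (s : ℂ) (φ : (Fin 2 → 𝔸[F]) → ℂ) (g : GL (Fin 2) 𝔸[F])

theorem tsum_enorm_thetaSummand_principalIdele_mul (a : Fˣ) (t : (𝔸[F])ˣ) :
    ∑' v : {v : Fin 2 → F // v ≠ 0}, ‖thetaSummand ω s φ g v.1 (principalIdele F a * t)‖ₑ =
      ∑' v : {v : Fin 2 → F // v ≠ 0}, ‖thetaSummand ω s φ g v.1 t‖ₑ := by
  let e : {v : Fin 2 → F // v ≠ 0} ≃ {v : Fin 2 → F // v ≠ 0} :=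
    { toFun := fun v => ⟨a • v.1, (smul_ne_zero_iff_ne a).2 v.2⟩
      invFun := fun v => ⟨a⁻¹ • v.1, (smul_ne_zero_iff_ne a⁻¹).2 v.2⟩
      left_inv := fun v => by simp
      right_inv := fun v => by simp }
  rw [← e.tsum_eq (fun v => ‖thetaSummand ω s φ g v.1 t‖ₑ)]
  exact tsum_congr fun v => by
    rw [thetaSummand_principalIdele_mul]
    rfl

variable [IsTotallyReal F] (μ : Measure (𝔸[F])ˣ) [μ.IsHaarMeasure]

/-- The sum over `v` of the integrals of `|ω(t) |t|^{2s} (gφ)(tv)|` over the idele class group is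
finite. -/
theorem setLIntegral_tsum_enorm_thetaSummand_lt_top {φ : (Fin 2 → 𝔸[F]) → ℂ}
    (hφ : φ ∈ schwartzBruhat F) (hs : 1 < s.re) {D : Set (𝔸[F])ˣ}
    (hD : IsFundamentalDomain (principalIdeles F).op D μ) :
    ∫⁻ t in D, ∑' v : {v : Fin 2 → F // v ≠ 0}, ‖thetaSummand ω s φ g v.1 t‖ₑ ∂μ < ⊤ := by
  obtain ⟨K, hK, hcover⟩ := exists_isCompact_principalIdele_mul_archTwo_zpow_mul F
  obtain ⟨b, hb, hle⟩ := exists_tsum_enorm_thetaSummand_le ω s g hφ hs hK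
  have : Countable (principalIdeles F).op := (principalIdeles F).equivOp.symm.injective.countable
  have hmeas : ∀ n : ℤ, μ ((fun t => archTwo F ^ n * t) '' K) = μ K := fun n => by
    rw [Set.image_mul_left, measure_preimage_mul]
  have hKn : ∀ n : ℤ, MeasurableSet ((fun t => archTwo F ^ n * t) '' K) := fun n =>
    (hK.image (continuous_const.mul continuous_id)).measurableSet
  refine (setLIntegral_le_tsum_of_isFundamentalDomain hD
    (fun n : ℤ => (fun t => archTwo F ^ n * t) '' K) (fun t => ?_) fun γ t => ?_).trans_lt ?_
  · obtain ⟨a, n, k, hk, rfl⟩ := hcover t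
    refine ⟨principalIdeleOp F a⁻¹, n, k, hk, ?_⟩
    rw [principalIdeleOp_smul, ← mul_assoc (principalIdele F a⁻¹), ← map_mul, inv_mul_cancel,
      map_one, one_mul]
  · obtain ⟨a, rfl⟩ := (principalIdeleOp F).surjective γ
    rw [principalIdeleOp_smul, tsum_enorm_thetaSummand_principalIdele_mul]
  · calc _ ≤ ∑' n : ℤ, ENNReal.ofReal |b n| * μ K := by
          refine ENNReal.tsum_le_tsum fun n => ?_
          rw [← hmeas n, ← setLIntegral_const]
          refine setLIntegral_mono' (hKn n) ?_
          rintro _ ⟨t, ht, rfl⟩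
          exact (hle t ht n).trans (ENNReal.ofReal_le_ofReal (le_abs_self _))
      _ = ENNReal.ofReal (∑' n, |b n|) * μ K := by
          rw [ENNReal.tsum_mul_right, ENNReal.ofReal_tsum_of_nonneg (fun _ => abs_nonneg _) hb.abs]
      _ < ⊤ := ENNReal.mul_lt_top ENNReal.ofReal_lt_top hK.measure_lt_top

theorem tsum_setLIntegral_enorm_thetaSummand_lt_top {φ : (Fin 2 → 𝔸[F]) → ℂ}
    (hφ : φ ∈ schwartzBruhat F) (hs : 1 < s.re) {D : Set (𝔸[F])ˣ}
    (hD : IsFundamentalDomain (principalIdeles F).op D μ) :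
    ∑' v : {v : Fin 2 → F // v ≠ 0}, ∫⁻ t in D, ‖thetaSummand ω s φ g v.1 t‖ₑ ∂μ < ⊤ := by
  have := countable_numberField F
  have hm (v : {v : Fin 2 → F // v ≠ 0}) :
      AEMeasurable (fun t => ‖thetaSummand ω s φ g v.1 t‖ₑ) (μ.restrict D) :=
    (continuous_thetaSummand ω s g hφ v.1).enorm.measurable.aemeasurable
  rw [← lintegral_tsum hm]
  exact setLIntegral_tsum_enorm_thetaSummand_lt_top ω s g μ hφ hs hD

/-- The absolute value of the integrand, summed over `Fˣ`, is the part of the theta series that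
comes from the vectors `(a, 0)`. -/
theorem integrable_zetaIntegrand {φ : (Fin 2 → 𝔸[F]) → ℂ} (hφ : φ ∈ schwartzBruhat F)
    (hs : 1 < s.re) : Integrable (zetaIntegrand ω s φ g) μ := by
  obtain ⟨D, -, hD⟩ := exists_isFundamentalDomain_principalIdeles μ
  have : Countable (principalIdeles F).op := (principalIdeles F).equivOp.symm.injective.countable
  refine ⟨(continuous_zetaIntegrand ω s g hφ).measurable.aestronglyMeasurable, ?_⟩
  rw [HasFiniteIntegral, hD.lintegral_eq_tsum'', ← (principalIdeleOp F).tsum_eq]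
  simp only [principalIdeleOp_smul, zetaIntegrand_principalIdele_mul]
  refine lt_of_le_of_lt ?_ (tsum_setLIntegral_enorm_thetaSummand_lt_top ω s g μ hφ hs hD)
  refine ENNReal.tsum_comp_le_tsum_of_injective
    (f := fun a : Fˣ => (⟨![(a : F), 0], vecCons_unit_ne_zero a⟩ : {v : Fin 2 → F // v ≠ 0}))
    (fun a b h => ?_) (fun v => ∫⁻ t in D, ‖thetaSummand ω s φ g v.1 t‖ₑ ∂μ)
  exact Units.ext (congrFun (congrArg Subtype.val h) 0)

/-- The integral over the ideles is the sum over `Fˣ` of the translated integrals over the idele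
class group; these are the contributions of the vectors `γ⁻¹ (a, 0)`. -/
theorem integral_zetaIntegrand_toAdelic_mul {φ : (Fin 2 → 𝔸[F]) → ℂ} (hφ : φ ∈ schwartzBruhat F)
    (hs : 1 < s.re) {D : Set (𝔸[F])ˣ} (hD : IsFundamentalDomain (principalIdeles F).op D μ)
    (γ : GL (Fin 2) F) :
    ∫ t, zetaIntegrand ω s φ (toAdelic F γ * g) t ∂μ = ∑' a : Fˣ, ∫ t in D, thetaSummand ω s φ g
      (((γ⁻¹ : GL (Fin 2) F) : Matrix (Fin 2) (Fin 2) F).mulVec ![(a : F), 0]) t ∂μ := by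
  have : Countable (principalIdeles F).op := (principalIdeles F).equivOp.symm.injective.countable
  rw [hD.integral_eq_tsum'' _ (integrable_zetaIntegrand ω s _ μ hφ hs),
    ← (principalIdeleOp F).tsum_eq]
  simp only [principalIdeleOp_smul, zetaIntegrand_toAdelic_mul]

/-- The theta series is a pointwise limit of its finite partial sums, which are continuous in
`t`. -/
theorem measurable_eisensteinClassIntegrand {φ : (Fin 2 → 𝔸[F]) → ℂ} (hφ : φ ∈ schwartzBruhat F) :
    Measurable (eisensteinClassIntegrand ω s φ g) := by
  refine QuotientGroup.measurable_from_quotient.2 ?_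
  have h : Measurable (eisensteinIntegrand ω s φ g) := by
    have hsum : ∀ t, HasSum (fun v : {v : Fin 2 → F // v ≠ 0} => thetaSummand ω s φ g v.1 t)
        (eisensteinIntegrand ω s φ g t) := fun t => by
      rw [eisensteinIntegrand_eq_tsum]
      refine Summable.hasSum ?_
      refine ((summable_thetaTerm (g * (Matrix.GeneralLinearGroup.scalar (Fin 2) t)⁻¹)
        hφ).mul_left (ω.eval t * (ideleNorm t : ℂ) ^ (2 * s))).congr fun v => ?_
      rw [thetaSummand, thetaTerm_mul_scalar_inv]
    have := countable_numberField F
    refine measurable_of_tendsto_metrizable' Filter.atTop (fun u => ?_)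
      (tendsto_pi_nhds.2 fun t => hsum t)
    exact Finset.measurable_sum u fun v _ => (continuous_thetaSummand ω s g hφ v.1).measurable
  exact h

theorem integrableOn_eisensteinIntegrand {φ : (Fin 2 → 𝔸[F]) → ℂ} (hφ : φ ∈ schwartzBruhat F)
    (hs : 1 < s.re) {D : Set (𝔸[F])ˣ} (hD : IsFundamentalDomain (principalIdeles F).op D μ) :
    IntegrableOn (eisensteinIntegrand ω s φ g) D μ := by
  refine ⟨((measurable_eisensteinClassIntegrand ω s g hφ).comp
    QuotientGroup.measurable_coe).aestronglyMeasurable, ?_⟩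
  refine (lintegral_mono fun t => ?_).trans_lt
    (setLIntegral_tsum_enorm_thetaSummand_lt_top ω s g μ hφ hs hD)
  rw [eisensteinIntegrand_eq_tsum]
  exact enorm_tsum_le_tsum_enorm

theorem hasSum_setIntegral_thetaSummand {φ : (Fin 2 → 𝔸[F]) → ℂ} (hφ : φ ∈ schwartzBruhat F)
    (hs : 1 < s.re) {D : Set (𝔸[F])ˣ} (hD : IsFundamentalDomain (principalIdeles F).op D μ) :
    HasSum (fun v : {v : Fin 2 → F // v ≠ 0} => ∫ t in D, thetaSummand ω s φ g v.1 t ∂μ)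
      (∫ t in D, eisensteinIntegrand ω s φ g t ∂μ) := by
  have := countable_numberField F
  have hfin := tsum_setLIntegral_enorm_thetaSummand_lt_top ω s g μ hφ hs hD
  have hint : ∀ v : {v : Fin 2 → F // v ≠ 0}, Integrable (thetaSummand ω s φ g v.1)
      (μ.restrict D) := fun v =>
    ⟨(continuous_thetaSummand ω s g hφ v.1).measurable.aestronglyMeasurable,
      (ENNReal.le_tsum v).trans_lt hfin⟩
  simp only [eisensteinIntegrand_eq_tsum]
  refine hasSum_integral_of_summable_integral_norm hint ?_
  have h := ENNReal.summable_toReal hfin.ne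
  refine h.congr fun v => ?_
  rw [integral_norm_eq_lintegral_enorm (hint v).1]

end Convergence

/-! ### Cosets of the Borel subgroup and unfolding -/

section Cosets
variable {F : Type*} [Field F]

theorem inv_mulVec_eq_iff (γ : GL (Fin 2) F) (v w : Fin 2 → F) :
    ((γ⁻¹ : GL (Fin 2) F) : Matrix (Fin 2) (Fin 2) F).mulVec v = w ↔
      v = (γ : Matrix (Fin 2) (Fin 2) F).mulVec w := by
  constructor
  · rintro rfl
    rw [Matrix.mulVec_mulVec, ← Units.val_mul, mul_inv_cancel, Units.val_one, Matrix.one_mulVec]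
  · rintro rfl
    rw [Matrix.mulVec_mulVec, ← Units.val_mul, inv_mul_cancel, Units.val_one, Matrix.one_mulVec]

theorem mulVec_vecCons_zero (A : Matrix (Fin 2) (Fin 2) F) (a : F) :
    A.mulVec ![a, 0] = ![A 0 0 * a, A 1 0 * a] := by
  ext i
  fin_cases i <;> simp [Matrix.mulVec, dotProduct, Fin.sum_univ_two]

theorem exists_generalLinearGroup_mulVec_eq {v : Fin 2 → F} (hv : v ≠ 0) :
    ∃ γ : GL (Fin 2) F, (γ : Matrix (Fin 2) (Fin 2) F).mulVec ![1, 0] = v := by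
  by_cases h : v 0 = 0
  · have h1 : v 1 ≠ 0 := fun h1 => hv (by ext i; fin_cases i; exacts [h, h1])
    refine ⟨Matrix.GeneralLinearGroup.mkOfDetNeZero !![v 0, 1; v 1, 0]
      (by simpa [Matrix.det_fin_two] using h1), ?_⟩
    rw [mulVec_vecCons_zero]
    ext i
    fin_cases i <;> simp [Matrix.GeneralLinearGroup.mkOfDetNeZero]
  · refine ⟨Matrix.GeneralLinearGroup.mkOfDetNeZero !![v 0, 0; v 1, 1]
      (by simpa [Matrix.det_fin_two] using h), ?_⟩
    rw [mulVec_vecCons_zero]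
    ext i
    fin_cases i <;> simp [Matrix.GeneralLinearGroup.mkOfDetNeZero]

variable (F) in
/-- The vector `γ⁻¹ (a, 0)`, where `γ` is the chosen representative of a coset in
`B(F)\GL₂(F)`. -/
noncomputable def cosetVector (p : Quotient (QuotientGroup.rightRel (borelSubgroup F)) × Fˣ) :
    {v : Fin 2 → F // v ≠ 0} :=
  ⟨(((p.1.out)⁻¹ : GL (Fin 2) F) : Matrix (Fin 2) (Fin 2) F).mulVec ![(p.2 : F), 0], fun h => by
    rw [inv_mulVec_eq_iff, Matrix.mulVec_zero] at h
    exact vecCons_unit_ne_zero p.2 h⟩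

/-- The group `GL₂(F)` acts transitively on the nonzero vectors, and `B(F)` is the stabiliser of
the line spanned by `(1, 0)`. Hence the pairs of a coset in `B(F)\GL₂(F)` and a scalar in `Fˣ`
parametrise the nonzero vectors. -/
theorem bijective_cosetVector : Function.Bijective (cosetVector F) := by
  constructor
  · rintro ⟨q, a⟩ ⟨r, b⟩ h
    have h1 := (inv_mulVec_eq_iff _ _ _).1 (congrArg Subtype.val h)
    rw [cosetVector] at h1
    dsimp only at h1
    rw [Matrix.mulVec_mulVec, ← Units.val_mul, mulVec_vecCons_zero] at h1
    have h10 := congrFun h1 1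
    have hqr : r = q := by
      rw [← Quotient.out_eq' r, ← Quotient.out_eq' q]
      refine Quotient.sound' ?_
      rw [QuotientGroup.rightRel_apply]
      exact (mul_eq_zero.1 h10.symm).resolve_right b.ne_zero
    subst hqr
    rw [mul_inv_cancel] at h1
    have h00 := congrFun h1 0
    refine Prod.ext rfl (Units.ext ?_)
    simpa using h00
  · rintro ⟨v, hv⟩
    obtain ⟨γ, hγ⟩ := exists_generalLinearGroup_mulVec_eq hv
    set q : Quotient (QuotientGroup.rightRel (borelSubgroup F)) := Quotient.mk'' γ⁻¹ with hq
    have hB : γ⁻¹ * q.out⁻¹ ∈ borelSubgroup F := by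
      rw [← QuotientGroup.rightRel_apply]
      exact Quotient.exact' (Quotient.out_eq' q)
    have hB' : q.out * γ ∈ borelSubgroup F := by
      have := (borelSubgroup F).inv_mem hB
      rwa [mul_inv_rev, inv_inv, inv_inv] at this
    set β : GL (Fin 2) F := q.out * γ with hβ
    have h10 : (β : Matrix (Fin 2) (Fin 2) F) 1 0 = 0 := hB'
    have h00 : (β : Matrix (Fin 2) (Fin 2) F) 0 0 ≠ 0 := by
      intro h0
      have hd := (Matrix.GeneralLinearGroup.det β).ne_zero
      rw [Matrix.GeneralLinearGroup.val_det_apply, Matrix.det_fin_two, h0, h10] at hd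
      simp at hd
    refine ⟨(q, Units.mk0 _ h00), Subtype.ext ?_⟩
    refine (inv_mulVec_eq_iff _ _ _).2 ?_
    dsimp only
    rw [← hγ, Matrix.mulVec_mulVec, ← Units.val_mul, ← hβ, mulVec_vecCons_zero, h10]
    simp

end Cosets

section Unfolding
variable {F : Type*} [Field F] [NumberField F]

theorem ideleNorm_det_toAdelic_mul (γ : GL (Fin 2) F) (g : GL (Fin 2) 𝔸[F]) :
    ideleNorm (Matrix.GeneralLinearGroup.det (toAdelic F γ * g)) =
      ideleNorm (Matrix.GeneralLinearGroup.det g) := by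
  have h : Matrix.GeneralLinearGroup.det (toAdelic F γ) =
      principalIdele F (Matrix.GeneralLinearGroup.det γ) := by
    ext
    exact ((algebraMap F 𝔸[F]).map_det _).symm
  rw [map_mul, map_mul, h, ideleNorm_principalIdele, one_mul]

theorem zetaCoset_eq_zetaIntegral_out (μ : Measure (𝔸[F])ˣ) [μ.IsHaarMeasure]
    (ω : UnitaryHeckeCharacter F) (s : ℂ) (φ : (Fin 2 → 𝔸[F]) → ℂ) (g : GL (Fin 2) 𝔸[F])
    (q : Quotient (QuotientGroup.rightRel (borelSubgroup F))) :
    zetaCoset μ ω s φ g q = zetaIntegral μ ω s φ (toAdelic F q.out * g) := by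
  conv_lhs => rw [← Quotient.out_eq' q]
  rfl

/-- Sorting the vectors in the theta series by their cosets turns the Eisenstein series into the
sum of the zeta integrals. -/
theorem hasSum_integral_zetaIntegrand [IsTotallyReal F] (μ : Measure (𝔸[F])ˣ) [μ.IsHaarMeasure]
    (ω : UnitaryHeckeCharacter F) {s : ℂ} (hs : 1 < s.re) {φ : (Fin 2 → 𝔸[F]) → ℂ}
    (hφ : φ ∈ schwartzBruhat F) (g : GL (Fin 2) 𝔸[F]) {D : Set (𝔸[F])ˣ}
    (hD : IsFundamentalDomain (principalIdeles F).op D μ) :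
    HasSum (fun q : Quotient (QuotientGroup.rightRel (borelSubgroup F)) =>
      ∫ t, zetaIntegrand ω s φ (toAdelic F q.out * g) t ∂μ)
      (∫ t in D, eisensteinIntegrand ω s φ g t ∂μ) := by
  have h := (Equiv.ofBijective _ (bijective_cosetVector (F := F))).hasSum_iff.2
    (hasSum_setIntegral_thetaSummand ω s g μ hφ hs hD)
  refine h.prod_fiberwise fun q => ?_
  rw [integral_zetaIntegrand_toAdelic_mul ω s g μ hφ hs hD]
  exact (h.summable.prod_factor q).hasSum

end Unfolding

end AdelicEisenstein

theorem mainTheorem3 (F : Type*) [Field F] [NumberField F] [IsTotallyReal F]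
    (μ : Measure (𝔸[F])ˣ) [μ.IsHaarMeasure]
    (ν : Measure ((𝔸[F])ˣ ⧸ AdelicEisenstein.principalIdeles F))
    [QuotientMeasureEqMeasurePreimage (G := (AdelicEisenstein.principalIdeles F).op) μ ν]
    (ω : AdelicEisenstein.UnitaryHeckeCharacter F) (s : ℂ) (hs : 1 < s.re)
    (φ : (Fin 2 → 𝔸[F]) → ℂ) (hφ : φ ∈ AdelicEisenstein.schwartzBruhat F)
    (g : GL (Fin 2) 𝔸[F]) :
    (∀ h : GL (Fin 2) 𝔸[F], Summable (AdelicEisenstein.thetaTerm φ h)) ∧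
    Integrable (AdelicEisenstein.eisensteinClassIntegrand ω s φ g) ν ∧
    (∀ h : GL (Fin 2) 𝔸[F], Integrable (AdelicEisenstein.zetaIntegrand ω s φ h) μ) ∧
    HasSum (AdelicEisenstein.zetaCoset μ ω s φ g)
      (AdelicEisenstein.eisensteinSeries ν ω s φ g) := by
  obtain ⟨D, -, hD⟩ := AdelicEisenstein.exists_isFundamentalDomain_principalIdeles μ
  have : Countable (AdelicEisenstein.principalIdeles F).op :=
    (AdelicEisenstein.principalIdeles F).equivOp.symm.injective.countable
  have hmp := hD.measurePreserving_quotient_mk ν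
  have hmeas := (AdelicEisenstein.measurable_eisensteinClassIntegrand ω s g hφ).aestronglyMeasurable
    (μ := ν)
  refine ⟨fun h => AdelicEisenstein.summable_thetaTerm h hφ, ?_,
    fun h => AdelicEisenstein.integrable_zetaIntegrand ω s h μ hφ hs, ?_⟩
  · exact (hmp.integrable_comp hmeas).1
      (AdelicEisenstein.integrableOn_eisensteinIntegrand ω s g μ hφ hs hD)
  · have hint : ∫ x, AdelicEisenstein.eisensteinClassIntegrand ω s φ g x ∂ν =
        ∫ t in D, AdelicEisenstein.eisensteinIntegrand ω s φ g t ∂μ := by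
      rw [← hmp.map_eq] at hmeas ⊢
      exact integral_map hmp.measurable.aemeasurable hmeas
    have h := AdelicEisenstein.hasSum_integral_zetaIntegrand μ ω hs hφ g hD
    rw [AdelicEisenstein.eisensteinSeries, hint]
    refine (h.mul_left _).congr_fun fun q => ?_
    rw [AdelicEisenstein.zetaCoset_eq_zetaIntegral_out, AdelicEisenstein.zetaIntegral,
      AdelicEisenstein.ideleNorm_det_toAdelic_mul]
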